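/- **Setting.** Let $X$ be a set of variables, each $x\in X$ having a sort $T_x$ of a many-sorted signature $\mathcal L$ (sorts, function symbols, relation symbols), and let $\mathcal C$ be a simplicial complex on $X$: a family of finite subsets of $X$ ("contexts") that is closed under subsets and contains every singleton. Formulas are those of regular logic over $\mathcal L$ (built from equations and relation symbols by $\top,\wedge,\exists$), up to renaming of bound variables. For finite $U\subseteq X$ let $\Phi_U$ be the set of formulas with free variables in $U$, let $\Phi_{\mathcal C}=\bigcup_{U\in\mathcal C}\Phi_U$, and for $\Gamma\subseteq\Phi_{\mathcal C}$ write $\Gamma_U=\Gamma\cap\Phi_U$. Let $\vdash$ be a regular theory, i.e. the (finitary) entailment relation generated in regular logic by a set of sequents $\varphi\vdash\psi$ in finite contexts; an entailment $\Gamma_U\vdash\varphi$ with $\varphi\in\Phi_U$ is taken in the context $U$. The inchworm fragment $\vdash_{\mathcal C}$ of $\vdash$ is the relation between subsets and elements of $\Phi_{\mathcal C}$ defined inductively by: (i) $\Gamma\vdash_{\mathcal C}\varphi$ if there is $U\in\mathcal C$ with $\varphi\in\Phi_U$ and $\Gamma_U\vdash\varphi$; (ii) if $\Gamma\vdash_{\mathcal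 C}\varphi$ and $\Delta\cup\{\varphi\}\vdash_{\mathcal C}\psi$, then $\Gamma\cup\Delta\vdash_{\mathcal C}\psi$. For an interpretation $[\![-]\!]$ of $\mathcal L$ in a regular category $\mathbf S$, let $F:\mathcal C^{\mathrm{op}}\to\mathbf S$ be the sheaf $F_U=\prod_{x\in U}[\![T_x]\!]$, whose restriction maps are the projections, and for $\varphi\in\Phi_U$ let $[\![\varphi]\!]_U\rightarrowtail F_U$ be the interpretation of $\varphi$ in the context $U$. The interpretation is a model of $\vdash$ if it satisfies all sequents of $\vdash$ (equivalently, the generating ones). A subpresheaf $A\rightarrowtail F$ is no-signalling if every restriction $A_{U\subseteq V}:A_V\to A_U$ (for $U\subseteq V\in\mathcal C$) is a regular epimorphism. Write $A\vDash\varphi$ if $A_U\leqslant[\![\varphi]\!]_U$ for every $U\in\mathcal C$ with $\varphi\in\Phi_U$; $A$ is a no-signalling model of $\Gamma$ if it is no-signalling and $A\vDash\psi$ for all $\psi\in\Gamma$. **Theorem.** Suppose that for every $\Gamma\subseteq\Phi_{\mathcal C}$ and every $U\in\mathcal C$ there is a finite $\Delta_U\subseteq\Gamma_U$ such that $\Delta_U\vdash\varphi$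 (in the context $U$) for all $\varphi\in\Gamma_U$. Then, for all $\Gamma\subseteq\Phi_{\mathcal C}$ and $\varphi\in\Phi_{\mathcal C}$, $\Gamma\vdash_{\mathcal C}\varphi$ if and only if $A\vDash\varphi$ for every no-signalling model $A$ of $\Gamma$ in every model $[\![-]\!]$ of $\vdash$ in every regular category. -/

import Mathlib

open CategoryTheory CategoryTheory.Limits Opposite

universe v w u

/-- A many-sorted first-order signature. -/
structure Signature where
  /-- the sorts (basic types) -/
  Srt : Type u
  /-- the function symbols (constants are those of arity zero) -/
  Fn : Type u
  fnArity : Fn → ℕ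
  fnDom : (f : Fn) → Fin (fnArity f) → Srt
  fnCod : Fn → Srt
  /-- the relation symbols -/
  Rel : Type u
  relArity : Rel → ℕ
  relDom : (R : Rel) → Fin (relArity R) → Srt

/-- Typed de Bruijn indices: `BVar l A` is the type of positions in the list `l` that hold `A`. -/
inductive BVar {B : Type u} : List B → B → Type u
  | zero {A : B} {l : List B} : BVar (A :: l) A
  | succ {A A' : B} {l : List B} : BVar l A → BVar (A' :: l) A

/-! ### Regular logic: terms and formulas

The variables are the named ones `x : X`, of sort `T x`, together with nameless (de Bruijn)
variables, which are used for binding and for the auxiliary contexts of derivations.  In particular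
formulas are formulas up to renaming of bound variables. -/

/-- Terms of a given sort, over the named variables `X` and the nameless variables `l`. -/
inductive Term {Sg : Signature.{u}} {X : Type u} (T : X → Sg.Srt) (l : List Sg.Srt) :
    Sg.Srt → Type u
  | var (x : X) : Term T l (T x)
  | bvar {A : Sg.Srt} (b : BVar l A) : Term T l A
  | app (f : Sg.Fn) (ts : (i : Fin (Sg.fnArity f)) → Term T l (Sg.fnDom f i)) :
      Term T l (Sg.fnCod f)

/-- Formulas of regular logic, over the named variables `X` and the nameless variables `l`. -/
inductive Formula {Sg : Signature.{u}} {X : Type u} (T : X → Sg.Srt) : List Sg.Srt → Type u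
  | top {l : List Sg.Srt} : Formula T l
  | and {l : List Sg.Srt} (φ ψ : Formula T l) : Formula T l
  | eq {l : List Sg.Srt} {A : Sg.Srt} (s t : Term T l A) : Formula T l
  | rel {l : List Sg.Srt} (R : Sg.Rel)
      (ts : (i : Fin (Sg.relArity R)) → Term T l (Sg.relDom R i)) : Formula T l
  | ex {l : List Sg.Srt} (A : Sg.Srt) (φ : Formula T (A :: l)) : Formula T l

section Logic

variable {Sg : Signature.{u}} {X : Type u} {T : X → Sg.Srt}

/-- All named variables of the term are in `U`. -/
def Term.InCtx (U : Finset X) {l : List Sg.Srt} : {A : Sg.Srt} → Term T l A → Prop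
  | _, .var x => x ∈ U
  | _, .bvar _ => True
  | _, .app _ ts => ∀ i, (ts i).InCtx U

/-- All named variables of the formula (they are all free) are in `U`. -/
def Formula.InCtx (U : Finset X) : {l : List Sg.Srt} → Formula T l → Prop
  | _, .top => True
  | _, .and φ ψ => φ.InCtx U ∧ ψ.InCtx U
  | _, .eq s t => s.InCtx U ∧ t.InCtx U
  | _, .rel _ ts => ∀ i, (ts i).InCtx U
  | _, .ex _ φ => φ.InCtx U

/-- Renaming of the nameless variables in a term. -/
def Term.rename {l l' : List Sg.Srt} (r : ∀ B, BVar l B → BVar l' B) :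
    {A : Sg.Srt} → Term T l A → Term T l' A
  | _, .var x => .var x
  | _, .bvar b => .bvar (r _ b)
  | _, .app f ts => .app f fun i => (ts i).rename r

/-- Simultaneous substitutions from variables (`X` and `l`) to terms over (`X` and `l'`). -/
structure Substitution {Sg : Signature.{u}} {X : Type u} (T : X → Sg.Srt)
    (l l' : List Sg.Srt) where
  var : (x : X) → Term T l' (T x)
  bvar : (B : Sg.Srt) → BVar l B → Term T l' B

namespace Substitution

/-- The substitution passed under a binder. -/
def lift {l l' : List Sg.Srt} (σ : Substitution T l l') (A : Sg.Srt) :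
    Substitution T (A :: l) (A :: l') where
  var x := (σ.var x).rename fun _ => .succ
  bvar
    | _, .zero => .bvar .zero
    | B, .succ b => (σ.bvar B b).rename fun _ => .succ

/-- The substitution `l → A :: l` that weakens by one new nameless variable. -/
def weaken (l : List Sg.Srt) (A : Sg.Srt) : Substitution T l (A :: l) where
  var x := .var x
  bvar _ b := .bvar (.succ b)

/-- The substitution of the term `t` for the most recent nameless variable. -/
def inst {l : List Sg.Srt} {A : Sg.Srt} (t : Term T l A) : Substitution T (A :: l) l where
  var x := .var x
  bvar
    | _, .zero => t
    | _, .succ b => .bvar b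

/-- `σ` sends every variable of the context `U, l` to a term in the context `U', l'`. -/
def Maps {l l' : List Sg.Srt} (σ : Substitution T l l') (U U' : Finset X) : Prop :=
  (∀ x ∈ U, (σ.var x).InCtx U') ∧ ∀ B b, (σ.bvar B b).InCtx U'

end Substitution

/-- Simultaneous substitution in a term. -/
def Term.subst {l l' : List Sg.Srt} (σ : Substitution T l l') :
    {A : Sg.Srt} → Term T l A → Term T l' A
  | _, .var x => σ.var x
  | _, .bvar b => σ.bvar _ b
  | _, .app f ts => .app f fun i => (ts i).subst σ

/-- Simultaneous (capture-avoiding) substitution in a formula. -/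
def Formula.subst : {l : List Sg.Srt} → Formula T l →
    {l' : List Sg.Srt} → Substitution T l l' → Formula T l'
  | _, .top, _, _ => .top
  | _, .and φ ψ, _, σ => .and (φ.subst σ) (ψ.subst σ)
  | _, .eq s t, _, σ => .eq (s.subst σ) (t.subst σ)
  | _, .rel R ts, _, σ => .rel R fun i => (ts i).subst σ
  | _, .ex A φ, _, σ => .ex A (φ.subst (σ.lift A))

/-- The same formula with one more (unused) nameless variable in the context. -/
def Formula.weaken {l : List Sg.Srt} (φ : Formula T l) (A : Sg.Srt) : Formula T (A :: l) :=
  φ.subst (Substitution.weaken l A)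

/-- The conjunction of a finite list of formulas. -/
def Formula.conj {l : List Sg.Srt} : List (Formula T l) → Formula T l
  | [] => .top
  | φ :: Δ => .and φ (Formula.conj Δ)

/-- A sequent-in-context `lhs ⊢ rhs` of regular logic; the context is finite and consists of the
named variables in `U` and the nameless variables in `l`. -/
structure Sequent {Sg : Signature.{u}} {X : Type u} (T : X → Sg.Srt) where
  U : Finset X
  l : List Sg.Srt
  lhs : Formula T l
  rhs : Formula T l
  lhs_inCtx : lhs.InCtx U
  rhs_inCtx : rhs.InCtx U

/-- Derivability of `φ ⊢ ψ` in the context `U, l`, in regular logic with axioms `Th`. -/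
inductive Derives (Th : Set (Sequent T)) :
    Finset X → (l : List Sg.Srt) → Formula T l → Formula T l → Prop
  | ax (s : Sequent T) : s ∈ Th → Derives Th s.U s.l s.lhs s.rhs
  | id {U : Finset X} {l : List Sg.Srt} {φ : Formula T l} : φ.InCtx U → Derives Th U l φ φ
  | cut {U : Finset X} {l : List Sg.Srt} {φ ψ χ : Formula T l} :
      Derives Th U l φ ψ → Derives Th U l ψ χ → Derives Th U l φ χ
  | subst {U U' : Finset X} {l l' : List Sg.Srt} {φ ψ : Formula T l} (σ : Substitution T l l') :
      σ.Maps U U' → Derives Th U l φ ψ → Derives Th U' l' (φ.subst σ) (ψ.subst σ)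
  | top {U : Finset X} {l : List Sg.Srt} {φ : Formula T l} : φ.InCtx U → Derives Th U l φ .top
  | and_left {U : Finset X} {l : List Sg.Srt} {φ ψ : Formula T l} :
      φ.InCtx U → ψ.InCtx U → Derives Th U l (.and φ ψ) φ
  | and_right {U : Finset X} {l : List Sg.Srt} {φ ψ : Formula T l} :
      φ.InCtx U → ψ.InCtx U → Derives Th U l (.and φ ψ) ψ
  | and_intro {U : Finset X} {l : List Sg.Srt} {φ ψ χ : Formula T l} :
      Derives Th U l φ ψ → Derives Th U l φ χ → Derives Th U l φ (.and ψ χ)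
  | eq_refl {U : Finset X} {l : List Sg.Srt} {A : Sg.Srt} {t : Term T l A} :
      t.InCtx U → Derives Th U l .top (.eq t t)
  | eq_subst {U : Finset X} {l : List Sg.Srt} {A : Sg.Srt} {s t : Term T l A}
      {φ : Formula T (A :: l)} : s.InCtx U → t.InCtx U → φ.InCtx U →
      Derives Th U l (.and (.eq s t) (φ.subst (Substitution.inst s)))
        (φ.subst (Substitution.inst t))
  | ex_left {U : Finset X} {l : List Sg.Srt} {A : Sg.Srt} {φ : Formula T (A :: l)}
      {ψ : Formula T l} : Derives Th U (A :: l) φ (ψ.weaken A) → Derives Th U l (.ex A φ) ψ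
  | ex_right {U : Finset X} {l : List Sg.Srt} {A : Sg.Srt} {φ : Formula T (A :: l)}
      {ψ : Formula T l} : Derives Th U l (.ex A φ) ψ → Derives Th U (A :: l) φ (ψ.weaken A)
  | frobenius {U : Finset X} {l : List Sg.Srt} {A : Sg.Srt} {φ : Formula T l}
      {ψ : Formula T (A :: l)} : φ.InCtx U → ψ.InCtx U →
      Derives Th U l (.and φ (.ex A ψ)) (.ex A (.and (φ.weaken A) ψ))

/-- The set `Φ_U` of the formulas in the context `U : T_U`. -/
def Phi (T : X → Sg.Srt) (U : Finset X) : Set (Formula T []) := {φ | φ.InCtx U}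

/-- The (global) entailment `Γ ⊢ φ`, in the context `U`, of the regular theory with axioms `Th`. -/
def Entails (Th : Set (Sequent T)) (U : Finset X) (Γ : Set (Formula T [])) (φ : Formula T []) :
    Prop :=
  ∃ Δ : List (Formula T []), (∀ ψ ∈ Δ, ψ ∈ Γ) ∧ Derives Th U [] (Formula.conj Δ) φ

end Logic

/-! ### Contexts and the inchworm logic -/

/-- A simplicial complex on `X`: a downward closed family of finite subsets of `X` that contains
every singleton. -/
structure ContextComplex (X : Type u) where
  faces : Set (Finset X)
  down_closed : ∀ ⦃U V : Finset X⦄, V ∈ faces → U ⊆ V → U ∈ faces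
  singleton_mem : ∀ x : X, {x} ∈ faces

namespace ContextComplex

variable {Sg : Signature.{u}} {X : Type u} {T : X → Sg.Srt}

/-- The poset of contexts, ordered by inclusion. -/
abbrev Face (C : ContextComplex X) : Type u := {U : Finset X // U ∈ C.faces}

/-- The contextual fragment `Φ_C`, the union of all `Φ_U` with `U` in `C`. -/
def PhiC (C : ContextComplex X) (T : X → Sg.Srt) : Set (Formula T []) := ⋃ U ∈ C.faces, Phi T U

/-- The inchworm fragment `Γ ⊢_C φ` of the regular theory with axioms `Th`. -/
inductive Inchworm (C : ContextComplex X) (Th : Set (Sequent T)) :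
    Set (Formula T []) → Formula T [] → Prop
  | base {Γ : Set (Formula T [])} {φ : Formula T []} (U : Finset X) :
      U ∈ C.faces → φ ∈ Phi T U → Entails Th U (Γ ∩ Phi T U) φ → Inchworm C Th Γ φ
  | cut {Γ Δ : Set (Formula T [])} {φ ψ : Formula T []} :
      Inchworm C Th Γ φ → Inchworm C Th (insert φ Δ) ψ → Inchworm C Th (Γ ∪ Δ) ψ

/-- For every set `Γ` of formulas of `Φ_C` and every context `U` in `C`, the set `Γ_U` is
axiomatised by a finite subset of it. -/
def LocallyFinitelyAxiomatised (C : ContextComplex X) (Th : Set (Sequent T)) : Prop :=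
  ∀ Γ ⊆ C.PhiC T, ∀ U ∈ C.faces,
    ∃ Δ : Set (Formula T []), Δ.Finite ∧ Δ ⊆ Γ ∩ Phi T U ∧ ∀ φ ∈ Γ ∩ Phi T U, Entails Th U Δ φ

end ContextComplex

/-! ### Semantics in regular categories -/

noncomputable section Semantics

/-- An interpretation of a signature in a regular category. -/
structure Interpretation (Sg : Signature.{u}) (S : Type w) [Category.{v} S] [Regular S] where
  obj : Sg.Srt → S
  fn : (f : Sg.Fn) → (∏ᶜ fun i => obj (Sg.fnDom f i)) ⟶ obj (Sg.fnCod f)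
  rel : (R : Sg.Rel) → Subobject (∏ᶜ fun i => obj (Sg.relDom R i))

namespace Interpretation

variable {Sg : Signature.{u}} {X : Type u} {T : X → Sg.Srt}
  {S : Type w} [Category.{v} S] [Regular S] (M : Interpretation Sg S)

/-- A term in the context `U, l`, at the object `P` together with arrows that give the values of
the variables of the context. -/
def term {U : Finset X} {P : S} (ρ : ∀ x ∈ U, P ⟶ M.obj (T x))
    {l : List Sg.Srt} (β : ∀ B, BVar l B → (P ⟶ M.obj B)) :
    {A : Sg.Srt} → (t : Term T l A) → t.InCtx U → (P ⟶ M.obj A)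
  | _, .var x, h => ρ x h
  | _, .bvar b, _ => β _ b
  | _, .app f ts, h => Pi.lift (fun i => term ρ β (ts i) (h i)) ≫ M.fn f

/-- The values of the nameless variables `A :: l` at `P ⨯ A`, given those of `l` at `P`. -/
def extend {P : S} {l : List Sg.Srt} (β : ∀ B, BVar l B → (P ⟶ M.obj B)) (A : Sg.Srt) :
    ∀ B, BVar (A :: l) B → (P ⨯ M.obj A ⟶ M.obj B)
  | _, .zero => prod.snd
  | B, .succ b => prod.fst ≫ β B b

/-- The subobject of `P` given by a formula in the context `U, l`, where `P` comes with arrows that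
give the values of the variables of the context. -/
def formula {U : Finset X} : {l : List Sg.Srt} → (φ : Formula T l) → φ.InCtx U →
    {P : S} → (∀ x ∈ U, P ⟶ M.obj (T x)) → (∀ B, BVar l B → (P ⟶ M.obj B)) → Subobject P
  | _, .top, _, _, _, _ => ⊤
  | _, .and φ ψ, h, _, ρ, β => formula φ h.1 ρ β ⊓ formula ψ h.2 ρ β
  | _, .eq s t, h, _, ρ, β => equalizerSubobject (M.term ρ β s h.1) (M.term ρ β t h.2)
  | _, .rel R ts, h, _, ρ, β =>
      (Subobject.pullback (Pi.lift fun i => M.term ρ β (ts i) (h i))).obj (M.rel R)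
  | _, .ex A φ, h, P, ρ, β =>
      (Subobject.exists (prod.fst : P ⨯ M.obj A ⟶ P)).obj
        (formula φ h (fun x hx => prod.fst ≫ ρ x hx) (M.extend β A))

/-- `F_U`, the product of the `⟦T x⟧` over `x ∈ U`. -/
abbrev ctx (T : X → Sg.Srt) (U : Finset X) : S := ∏ᶜ fun x : {x // x ∈ U} => M.obj (T x)

/-- The object interpreting the context `U, l`. -/
def fullCtx (T : X → Sg.Srt) (U : Finset X) : List Sg.Srt → S
  | [] => M.ctx T U
  | A :: l => fullCtx T U l ⨯ M.obj A

/-- The projections from the context to its named variables. -/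
def namedProj (U : Finset X) : (l : List Sg.Srt) → ∀ x ∈ U, M.fullCtx T U l ⟶ M.obj (T x)
  | [], x, hx => Pi.π (fun x : {x // x ∈ U} => M.obj (T x)) ⟨x, hx⟩
  | _ :: l, x, hx => prod.fst ≫ namedProj U l x hx

/-- The projections from the context to its nameless variables. -/
def namelessProj (T : X → Sg.Srt) (U : Finset X) :
    (l : List Sg.Srt) → ∀ B, BVar l B → (M.fullCtx T U l ⟶ M.obj B)
  | [], _, b => nomatch b
  | A :: l, B, b => M.extend (namelessProj T U l) A B b

/-- `⟦φ⟧` in the context `U, l`. -/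
def interp (U : Finset X) {l : List Sg.Srt} (φ : Formula T l) (h : φ.InCtx U) :
    Subobject (M.fullCtx T U l) :=
  M.formula φ h (M.namedProj U l) (M.namelessProj T U l)

/-- `⟦φ⟧_U`, a subobject of `F_U`, for `φ` in `Φ_U`. -/
def phi (U : Finset X) (φ : Formula T []) (h : φ ∈ Phi T U) : Subobject (M.ctx T U) :=
  M.interp U φ h

/-- `M` models the regular theory with axioms `Th`. -/
def IsModel (Th : Set (Sequent T)) : Prop :=
  ∀ s ∈ Th, M.interp s.U s.lhs s.lhs_inCtx ≤ M.interp s.U s.rhs s.rhs_inCtx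

variable (T) in
/-- The sheaf `F : U ↦ F_U` on the poset of contexts, with the projections as restrictions. -/
def sheaf (C : ContextComplex X) : C.Faceᵒᵖ ⥤ S where
  obj U := M.ctx T U.unop.1
  map {V U} f := Pi.lift fun x : {x // x ∈ U.unop.1} =>
    Pi.π (fun x : {x // x ∈ V.unop.1} => M.obj (T x)) ⟨x.1, f.unop.le x.2⟩
  map_id U := by
    apply Pi.hom_ext
    intro x
    simp
  map_comp f g := by
    apply Pi.hom_ext
    intro x
    simp

variable {M} {C : ContextComplex X}

/-- The subpresheaf `ι : A ↣ F` is a model of `φ`: `A_U ≤ ⟦φ⟧_U` for every context `U` in `C` such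
that `φ` is in `Φ_U`. -/
def Models {A : C.Faceᵒᵖ ⥤ S} (ι : A ⟶ M.sheaf T C) [Mono ι] (φ : Formula T []) : Prop :=
  ∀ (U : C.Face) (h : φ ∈ Phi T U.1), Subobject.mk (ι.app (op U)) ≤ M.phi U.1 φ h

end Interpretation

/-- A presheaf on the contexts is no-signalling: all its restrictions are regular epis. -/
def NoSignalling {X : Type u} {C : ContextComplex X} {S : Type w} [Category.{v} S]
    (A : C.Faceᵒᵖ ⥤ S) : Prop :=
  ∀ ⦃V U : C.Faceᵒᵖ⦄ (f : V ⟶ U), IsRegularEpi (A.map f)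

end Semantics

/-! Soundness. A no-signalling `A` satisfies `φ` in all contexts as soon as it does in one context
`U`. If `φ` also lives in `V`, then it lives in `U ∩ V`; the restriction from `A_U` to `A_(U ∩ V)`
is a regular epimorphism, hence strong, so membership in `⟦φ⟧` descends along it, and it then pulls
back to `V` (`models_of_face`). With this, rule (i) is soundness of regular logic (`IsModel.sound`)
and rule (ii) is immediate (`models_of_inchworm`).

Completeness. Let `G` be the set of inchworm consequences of `Γ`, and let the finite list `Δ U`
axiomatise `G` in the context `U`. If `φ`, living in `U`, is not in `G`, then `Δ U` does not prove
`φ`, since a single context step would otherwise put `φ` in `G`. Completeness of regular logic over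
sets (`exists_setStructure_of_not_derives`) gives a set model of the theory with an assignment on
`U` that satisfies `Δ U` but not `φ`. In this model put `A_V = ⟦⋀ Δ V⟧`. It is a presheaf that
satisfies all of `G`, hence `Γ`, but not `φ`. It is no-signalling because `G` is closed: for `V = U
∪ {y}`, the formula `∃ y, ⋀ Δ V` follows from `Δ V`, so it is in `G`; it lives in `U`, so `Δ U`
proves it, and every element of `A_U` extends to `A_V` (`exists_extension`, `noSignalling`).
Finiteness of `Δ V` is what makes the conjunction a formula.

The set model is built by forcing. A condition (`Stage`) is a formula conservative over `δ = ⋀ Δ U`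
with a partial valuation of names. Elements are names that are densely defined, and truth means
holding on a dense set of conditions. For regular formulas no generic filter is needed: conjunctions
pass through because holding is monotone, and a densely true existential is witnessed by one name,
whose value may differ between conditions (`forced_wit`, `sat_iff`).

The target categories have bounded size, so this model is moved into a small regular category of
sets, `SmallSet`. -/

section RegularLogic

variable {Sg : Signature.{u}} {X : Type u} {T : X → Sg.Srt}

/-! ### Contexts and the calculus of substitutions. -/

theorem Term.InCtx.mono {U V : Finset X} (h : U ⊆ V) {l : List Sg.Srt} {A : Sg.Srt}
    {t : Term T l A} (ht : t.InCtx U) : t.InCtx V := by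
  induction t with
  | var x => exact h ht
  | bvar b => trivial
  | app f ts ih => exact fun i => ih i (ht i)

theorem Formula.InCtx.mono {U V : Finset X} (h : U ⊆ V) {l : List Sg.Srt}
    {φ : Formula T l} (hφ : φ.InCtx U) : φ.InCtx V := by
  induction φ with
  | top => trivial
  | and φ ψ ih₁ ih₂ => exact ⟨ih₁ hφ.1, ih₂ hφ.2⟩
  | eq s t => exact ⟨hφ.1.mono h, hφ.2.mono h⟩
  | rel R ts => exact fun i => (hφ i).mono h
  | ex A φ ih => exact ih hφ

theorem Term.InCtx.inter [DecidableEq X] {U V : Finset X} {l : List Sg.Srt} {A : Sg.Srt}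
    {t : Term T l A} (hU : t.InCtx U) (hV : t.InCtx V) : t.InCtx (U ∩ V) := by
  induction t with
  | var x => exact Finset.mem_inter.2 ⟨hU, hV⟩
  | bvar b => trivial
  | app f ts ih => exact fun i => ih i (hU i) (hV i)

/-- Being in a context is a condition on the named variables that occur. This is what lets two
contexts of the same formula be compared through a common face. -/
theorem Formula.InCtx.inter [DecidableEq X] {U V : Finset X} {l : List Sg.Srt}
    {φ : Formula T l} (hU : φ.InCtx U) (hV : φ.InCtx V) : φ.InCtx (U ∩ V) := by
  induction φ with
  | top => trivial
  | and φ ψ ih₁ ih₂ => exact ⟨ih₁ hU.1 hV.1, ih₂ hU.2 hV.2⟩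
  | eq s t => exact ⟨hU.1.inter hV.1, hU.2.inter hV.2⟩
  | rel R ts => exact fun i => (hU i).inter (hV i)
  | ex A φ ih => exact ih hU hV

theorem Term.rename_inCtx {U : Finset X} {l l' : List Sg.Srt} (r : ∀ B, BVar l B → BVar l' B)
    {A : Sg.Srt} {t : Term T l A} : (t.rename r).InCtx U ↔ t.InCtx U := by
  induction t with
  | var x => exact Iff.rfl
  | bvar b => exact Iff.rfl
  | app f ts ih => exact forall_congr' ih

theorem Term.InCtx.subst {U V : Finset X} {l l' : List Sg.Srt} {σ : Substitution T l l'}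
    (hσ : σ.Maps U V) {A : Sg.Srt} {t : Term T l A} (ht : t.InCtx U) : (t.subst σ).InCtx V := by
  induction t with
  | var x => exact hσ.1 x ht
  | bvar b => exact hσ.2 _ b
  | app f ts ih => exact fun i => ih i (ht i)

theorem Substitution.Maps.lift {U V : Finset X} {l l' : List Sg.Srt} {σ : Substitution T l l'}
    (hσ : σ.Maps U V) (A : Sg.Srt) : (σ.lift A).Maps U V := by
  refine ⟨fun x hx => (Term.rename_inCtx _).2 (hσ.1 x hx), fun B b => ?_⟩
  cases b with
  | zero => trivial
  | succ b => exact (Term.rename_inCtx _).2 (hσ.2 _ b)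

theorem Formula.InCtx.subst {U V : Finset X} {l : List Sg.Srt} {φ : Formula T l}
    (hφ : φ.InCtx U) {l' : List Sg.Srt} {σ : Substitution T l l'} (hσ : σ.Maps U V) :
    (φ.subst σ).InCtx V := by
  induction φ generalizing l' with
  | top => trivial
  | and φ ψ ih₁ ih₂ => exact ⟨ih₁ hφ.1 hσ, ih₂ hφ.2 hσ⟩
  | eq s t => exact ⟨hφ.1.subst hσ, hφ.2.subst hσ⟩
  | rel R ts => exact fun i => (hφ i).subst hσ
  | ex A φ ih => exact ih hφ (hσ.lift A)

namespace Substitution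

theorem weaken_maps (U : Finset X) (l : List Sg.Srt) (A : Sg.Srt) :
    (weaken (T := T) l A).Maps U U :=
  ⟨fun _ hx => hx, fun _ _ => trivial⟩

theorem inst_maps {U : Finset X} {l : List Sg.Srt} {A : Sg.Srt} {t : Term T l A}
    (ht : t.InCtx U) : (inst t).Maps U U :=
  ⟨fun _ hx => hx, fun _ b => by cases b with
    | zero => exact ht
    | succ b => trivial⟩

/-- Composition of substitutions: first `σ`, then `τ`. -/
def comp {l l' l'' : List Sg.Srt} (σ : Substitution T l l') (τ : Substitution T l' l'') :
    Substitution T l l'' where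
  var x := (σ.var x).subst τ
  bvar B b := (σ.bvar B b).subst τ

/-- The substitution that extends `σ` by the term `t` for the most recent nameless variable. -/
def cons {l l' : List Sg.Srt} {A : Sg.Srt} (t : Term T l' A) (σ : Substitution T l l') :
    Substitution T (A :: l) l' where
  var := σ.var
  bvar
    | _, .zero => t
    | B, .succ b => σ.bvar B b

/-- The identity substitution. -/
def ident (T : X → Sg.Srt) (l : List Sg.Srt) : Substitution T l l where
  var x := .var x
  bvar _ b := .bvar b

theorem Maps.comp {U V W : Finset X} {l l' l'' : List Sg.Srt} {σ : Substitution T l l'}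
    {τ : Substitution T l' l''} (hσ : σ.Maps U V) (hτ : τ.Maps V W) : (σ.comp τ).Maps U W :=
  ⟨fun x hx => (hσ.1 x hx).subst hτ, fun B b => (hσ.2 B b).subst hτ⟩

theorem ident_maps (U : Finset X) (l : List Sg.Srt) : (ident T l).Maps U U :=
  ⟨fun _ hx => hx, fun _ _ => trivial⟩

/-- Two substitutions agree on the variables of the context `U, l`. -/
def Agree (U : Finset X) {l l' : List Sg.Srt} (σ τ : Substitution T l l') : Prop :=
  (∀ x ∈ U, σ.var x = τ.var x) ∧ ∀ B b, σ.bvar B b = τ.bvar B b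

theorem Agree.lift {U : Finset X} {l l' : List Sg.Srt} {σ τ : Substitution T l l'}
    (h : Agree U σ τ) (A : Sg.Srt) : Agree U (σ.lift A) (τ.lift A) := by
  refine ⟨fun x hx => ?_, fun B b => ?_⟩
  · simp only [Substitution.lift, h.1 x hx]
  · cases b with
    | zero => rfl
    | succ b => simp only [Substitution.lift, h.2]

end Substitution

theorem Term.subst_congr {U : Finset X} {l l' : List Sg.Srt} {σ τ : Substitution T l l'}
    (h : Substitution.Agree U σ τ) {A : Sg.Srt} {t : Term T l A} (ht : t.InCtx U) :
    t.subst σ = t.subst τ := by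
  induction t with
  | var x => exact h.1 x ht
  | bvar b => exact h.2 _ b
  | app f ts ih => exact congrArg _ (funext fun i => ih i (ht i))

/-- Substitutions are total, but only their values on the context matter; valuations of parameters
determine them only there. -/
theorem Formula.subst_congr {U : Finset X} {l : List Sg.Srt} {φ : Formula T l}
    (hφ : φ.InCtx U) {l' : List Sg.Srt} {σ τ : Substitution T l l'}
    (h : Substitution.Agree U σ τ) : φ.subst σ = φ.subst τ := by
  induction φ generalizing l' with
  | top => rfl
  | and φ ψ ih₁ ih₂ => exact congrArg₂ _ (ih₁ hφ.1 h) (ih₂ hφ.2 h)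
  | eq s t => exact congrArg₂ _ (Term.subst_congr h hφ.1) (Term.subst_congr h hφ.2)
  | rel R ts => exact congrArg (Formula.rel R) (funext fun i => Term.subst_congr h (hφ i))
  | ex A φ ih => exact congrArg (Formula.ex A) (ih hφ (h.lift A))

namespace Substitution

theorem ext_of {l l' : List Sg.Srt} {σ τ : Substitution T l l'}
    (h₁ : ∀ x, σ.var x = τ.var x) (h₂ : ∀ B b, σ.bvar B b = τ.bvar B b) : σ = τ := by
  cases σ; cases τ
  congr
  · exact funext h₁
  · exact funext fun B => funext fun b => h₂ B b

end Substitution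

theorem Term.rename_subst {l l' l'' : List Sg.Srt} (r : ∀ B, BVar l B → BVar l' B)
    (τ : Substitution T l' l'') {A : Sg.Srt} (t : Term T l A) :
    (t.rename r).subst τ = t.subst ⟨τ.var, fun B b => τ.bvar B (r B b)⟩ := by
  induction t with
  | var x => rfl
  | bvar b => rfl
  | app f ts ih => exact congrArg _ (funext ih)

theorem Term.subst_rename {l l' l'' : List Sg.Srt} (σ : Substitution T l l')
    (r : ∀ B, BVar l' B → BVar l'' B) {A : Sg.Srt} (t : Term T l A) :
    (t.subst σ).rename r =
      t.subst ⟨fun x => (σ.var x).rename r, fun B b => (σ.bvar B b).rename r⟩ := by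
  induction t with
  | var x => rfl
  | bvar b => rfl
  | app f ts ih => exact congrArg _ (funext ih)

theorem Term.subst_subst {l l' l'' : List Sg.Srt} (σ : Substitution T l l')
    (τ : Substitution T l' l'') {A : Sg.Srt} (t : Term T l A) :
    (t.subst σ).subst τ = t.subst (σ.comp τ) := by
  induction t with
  | var x => rfl
  | bvar b => rfl
  | app f ts ih => exact congrArg _ (funext ih)

theorem Term.subst_ident {l : List Sg.Srt} {A : Sg.Srt} (t : Term T l A) :
    t.subst (.ident T l) = t := by
  induction t with
  | var x => rfl
  | bvar b => rfl
  | app f ts ih => exact congrArg _ (funext ih)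

theorem Substitution.lift_comp_lift {l l' l'' : List Sg.Srt} (σ : Substitution T l l')
    (τ : Substitution T l' l'') (A : Sg.Srt) :
    (σ.lift A).comp (τ.lift A) = (σ.comp τ).lift A := by
  refine Substitution.ext_of (fun x => ?_) fun B b => ?_
  · exact (Term.rename_subst _ _ _).trans (Term.subst_rename _ _ _).symm
  · cases b with
    | zero => rfl
    | succ b => exact (Term.rename_subst _ _ _).trans (Term.subst_rename _ _ _).symm

theorem Substitution.lift_ident (l : List Sg.Srt) (A : Sg.Srt) :
    (Substitution.ident T l).lift A = .ident T (A :: l) := by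
  refine Substitution.ext_of (fun x => rfl) fun B b => ?_
  cases b <;> rfl

theorem Formula.subst_subst {l : List Sg.Srt} (φ : Formula T l) {l' l'' : List Sg.Srt}
    (σ : Substitution T l l') (τ : Substitution T l' l'') :
    (φ.subst σ).subst τ = φ.subst (σ.comp τ) := by
  induction φ generalizing l' l'' with
  | top => rfl
  | and φ ψ ih₁ ih₂ => exact congrArg₂ _ (ih₁ _ _) (ih₂ _ _)
  | eq s t => exact congrArg₂ _ (s.subst_subst _ _) (t.subst_subst _ _)
  | rel R ts => exact congrArg _ (funext fun i => (ts i).subst_subst _ _)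
  | ex A φ ih =>
    refine congrArg _ ((ih _ _).trans ?_)
    rw [Substitution.lift_comp_lift]

theorem Formula.subst_ident {l : List Sg.Srt} (φ : Formula T l) : φ.subst (.ident T l) = φ := by
  induction φ with
  | top => rfl
  | and φ ψ ih₁ ih₂ => exact congrArg₂ _ ih₁ ih₂
  | eq s t => exact congrArg₂ _ s.subst_ident t.subst_ident
  | rel R ts => exact congrArg _ (funext fun i => (ts i).subst_ident)
  | ex A φ ih =>
    refine congrArg (Formula.ex A) ?_
    rw [Substitution.lift_ident]
    exact ih

theorem Term.rename_succ {l : List Sg.Srt} {A B : Sg.Srt} (t : Term T l B) :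
    t.rename (fun _ => BVar.succ (A' := A)) = t.subst (.weaken l A) := by
  induction t with
  | var x => rfl
  | bvar b => rfl
  | app f ts ih => exact congrArg _ (funext ih)

theorem Term.weaken_inst {l : List Sg.Srt} {A B : Sg.Srt} (t : Term T l B) (s : Term T l A) :
    (t.subst (.weaken l A)).subst (.inst s) = t := by
  rw [Term.subst_subst]
  exact t.subst_ident

theorem Term.bvar_zero_inst {l : List Sg.Srt} {A : Sg.Srt} (s : Term T l A) :
    (Term.bvar BVar.zero : Term T (A :: l) A).subst (.inst s) = s := rfl

theorem Substitution.lift_comp_inst {l l' : List Sg.Srt} {A : Sg.Srt} (σ : Substitution T l l')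
    (t : Term T l' A) : (σ.lift A).comp (.inst t) = .cons t σ := by
  refine Substitution.ext_of (fun x => ?_) fun B b => ?_
  · exact (congrArg _ (Term.rename_succ _)).trans (Term.weaken_inst _ _)
  · cases b with
    | zero => rfl
    | succ b => exact (congrArg _ (Term.rename_succ _)).trans (Term.weaken_inst _ _)

theorem Formula.weaken_inst {l : List Sg.Srt} {A : Sg.Srt} (φ : Formula T l)
    (s : Term T l A) : (φ.weaken A).subst (.inst s) = φ := by
  rw [Formula.weaken, Formula.subst_subst]
  exact φ.subst_ident

/-- The hypothesis says that `σ` hides no named variable outside `U`. It holds for weakening, whose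
converse direction on contexts is what is needed. -/
theorem Term.inCtx_of_subst {U : Finset X} {l l' : List Sg.Srt} {σ : Substitution T l l'}
    (hσ : ∀ x, (σ.var x).InCtx U → x ∈ U) {A : Sg.Srt} {t : Term T l A}
    (ht : (t.subst σ).InCtx U) : t.InCtx U := by
  induction t with
  | var x => exact hσ x ht
  | bvar b => trivial
  | app f ts ih => exact fun i => ih i (ht i)

theorem Formula.inCtx_of_subst {U : Finset X} {l : List Sg.Srt} {φ : Formula T l}
    {l' : List Sg.Srt} {σ : Substitution T l l'} (hσ : ∀ x, (σ.var x).InCtx U → x ∈ U)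
    (hφ : (φ.subst σ).InCtx U) : φ.InCtx U := by
  induction φ generalizing l' with
  | top => trivial
  | and φ ψ ih₁ ih₂ => exact ⟨ih₁ hσ hφ.1, ih₂ hσ hφ.2⟩
  | eq s t => exact ⟨Term.inCtx_of_subst hσ hφ.1, Term.inCtx_of_subst hσ hφ.2⟩
  | rel R ts => exact fun i => Term.inCtx_of_subst hσ (hφ i)
  | ex A φ ih => exact ih (σ := σ.lift A) (fun x hx => hσ x ((Term.rename_inCtx _).1 hx)) hφ

theorem Formula.weaken_inCtx {U : Finset X} {l : List Sg.Srt} {A : Sg.Srt} {φ : Formula T l} :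
    (φ.weaken A).InCtx U ↔ φ.InCtx U :=
  ⟨Formula.inCtx_of_subst fun _ hx => hx, fun h => h.subst (Substitution.weaken_maps U l A)⟩

theorem Formula.conj_inCtx {U : Finset X} {l : List Sg.Srt} {Δ : List (Formula T l)} :
    (Formula.conj Δ).InCtx U ↔ ∀ φ ∈ Δ, φ.InCtx U := by
  induction Δ with
  | nil => simp [Formula.conj, Formula.InCtx]
  | cons φ Δ ih => simp [Formula.conj, Formula.InCtx, ih]

/-- The unique assignment to the empty list of nameless variables. -/
def BVar.elim0 {B : Type u} {F : B → Sort v} (A : B) (b : BVar [] A) : F A := nomatch b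

/-! ### Derived rules: conjunctions, existential introduction, equality and congruence. -/

namespace Derives

variable {Th : Set (Sequent T)} {U : Finset X} {l : List Sg.Srt}

/-- Every rule carries enough side conditions for this; it supplies the context proofs that
interpreting a derived formula requires. -/
theorem inCtx {φ ψ : Formula T l} (h : Derives Th U l φ ψ) : φ.InCtx U ∧ ψ.InCtx U := by
  induction h with
  | ax s hs => exact ⟨s.lhs_inCtx, s.rhs_inCtx⟩
  | id h => exact ⟨h, h⟩
  | cut _ _ h₁ h₂ => exact ⟨h₁.1, h₂.2⟩
  | subst σ hσ _ ih => exact ⟨ih.1.subst hσ, ih.2.subst hσ⟩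
  | top h => exact ⟨h, trivial⟩
  | and_left h₁ h₂ => exact ⟨⟨h₁, h₂⟩, h₁⟩
  | and_right h₁ h₂ => exact ⟨⟨h₁, h₂⟩, h₂⟩
  | and_intro _ _ h₁ h₂ => exact ⟨h₁.1, h₁.2, h₂.2⟩
  | eq_refl h => exact ⟨trivial, h, h⟩
  | eq_subst hs ht hφ =>
    exact ⟨⟨⟨hs, ht⟩, hφ.subst (Substitution.inst_maps hs)⟩,
      hφ.subst (Substitution.inst_maps ht)⟩
  | ex_left _ ih => exact ⟨ih.1, Formula.weaken_inCtx.1 ih.2⟩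
  | ex_right _ ih => exact ⟨ih.1, Formula.weaken_inCtx.2 ih.2⟩
  | frobenius hφ hψ => exact ⟨⟨hφ, hψ⟩, Formula.weaken_inCtx.2 hφ, hψ⟩

theorem conj_of_mem {Δ : List (Formula T l)} (hΔ : ∀ φ ∈ Δ, φ.InCtx U) {φ : Formula T l}
    (h : φ ∈ Δ) : Derives Th U l (Formula.conj Δ) φ := by
  induction Δ with
  | nil => simp at h
  | cons ψ Δ ih =>
    have hψ : ψ.InCtx U := hΔ ψ (by simp)
    have hc : (Formula.conj Δ).InCtx U :=
      Formula.conj_inCtx.2 fun χ hχ => hΔ χ (by simp [hχ])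
    rcases List.mem_cons.1 h with rfl | h
    · exact and_left hψ hc
    · exact (and_right hψ hc).cut (ih (fun χ hχ => hΔ χ (by simp [hχ])) h)

theorem conj_intro {φ : Formula T l} (hφ : φ.InCtx U) {Δ : List (Formula T l)}
    (h : ∀ ψ ∈ Δ, Derives Th U l φ ψ) : Derives Th U l φ (Formula.conj Δ) := by
  induction Δ with
  | nil => exact top hφ
  | cons ψ Δ ih => exact and_intro (h ψ (by simp)) (ih fun χ hχ => h χ (by simp [hχ]))

theorem ex_intro {A : Sg.Srt} {φ : Formula T (A :: l)} (hφ : φ.InCtx U) {t : Term T l A}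
    (ht : t.InCtx U) : Derives Th U l (φ.subst (.inst t)) (.ex A φ) := by
  have h := subst (.inst t) (Substitution.inst_maps ht)
    (ex_right (Derives.id (Th := Th) (U := U) (φ := .ex A φ) hφ))
  rwa [Formula.weaken_inst] at h

theorem eq_elim {θ : Formula T l} {A : Sg.Srt} {s t : Term T l A} {φ : Formula T (A :: l)}
    (hφ : φ.InCtx U) (hst : Derives Th U l θ (.eq s t))
    (hs : Derives Th U l θ (φ.subst (.inst s))) : Derives Th U l θ (φ.subst (.inst t)) :=
  (and_intro hst hs).cut (eq_subst hst.inCtx.2.1 hst.inCtx.2.2 hφ)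

theorem eq_rfl {θ : Formula T l} (hθ : θ.InCtx U) {A : Sg.Srt} {t : Term T l A}
    (ht : t.InCtx U) : Derives Th U l θ (.eq t t) :=
  (top hθ).cut (eq_refl ht)

theorem eq_symm {θ : Formula T l} {A : Sg.Srt} {s t : Term T l A}
    (h : Derives Th U l θ (.eq s t)) : Derives Th U l θ (.eq t s) := by
  have hs := h.inCtx.2.1
  -- Leibniz's rule for the predicate `z = s`, with `z` the new nameless variable.
  have h' := eq_elim (φ := .eq (.bvar .zero) (s.subst (.weaken l A)))
    ⟨trivial, hs.subst (Substitution.weaken_maps U l A)⟩ h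
    (by simpa only [Formula.subst, Term.weaken_inst, Term.bvar_zero_inst] using eq_rfl h.inCtx.1 hs)
  simpa only [Formula.subst, Term.weaken_inst, Term.bvar_zero_inst] using h'

theorem eq_trans {θ : Formula T l} {A : Sg.Srt} {s t r : Term T l A}
    (h₁ : Derives Th U l θ (.eq s t)) (h₂ : Derives Th U l θ (.eq t r)) :
    Derives Th U l θ (.eq s r) := by
  have h' := eq_elim (φ := .eq (s.subst (.weaken l A)) (.bvar .zero))
    ⟨h₁.inCtx.2.1.subst (Substitution.weaken_maps U l A), trivial⟩ h₂
    (by simpa only [Formula.subst, Term.weaken_inst, Term.bvar_zero_inst] using h₁)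
  simpa only [Formula.subst, Term.weaken_inst, Term.bvar_zero_inst] using h'

/-- Replacement of a finite family of terms by provably equal ones. -/
theorem congr_family {θ : Formula T l} {n : ℕ} {s : Fin n → Sg.Srt}
    (P : (∀ i, Term T l (s i)) → Prop)
    (hP : ∀ (ts : ∀ i, Term T l (s i)) (i : Fin n) (t : Term T l (s i)),
      (∀ j, (ts j).InCtx U) → Derives Th U l θ (.eq (ts i) t) → P ts →
      P (Function.update ts i t))
    {ts ts' : ∀ i, Term T l (s i)} (h : ∀ i, Derives Th U l θ (.eq (ts i) (ts' i)))
    (hts : P ts) : P ts' := by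
  classical
  -- The equality rule acts on a single variable, so the terms are exchanged one index at a time;
  -- `S` is the set of indices already exchanged.
  have key : ∀ S : Finset (Fin n), P fun i => if i ∈ S then ts' i else ts i := by
    intro S
    induction S using Finset.induction_on with
    | empty => simpa using hts
    | insert i S hi ih =>
      have h' := hP _ i (ts' i) (fun j => ?_) ?_ ih
      · convert h' using 1
        funext j
        rcases eq_or_ne j i with rfl | hj
        · simp
        · simp [hj]
      · split
        · exact (h j).inCtx.2.2
        · exact (h j).inCtx.2.1
      · simpa [hi] using h i
  simpa using key Finset.univ

/-- The tuple with a hole at position `i`: filling the hole with `t` overwrites that entry. It turns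
a replacement in one argument into an instance of `eq_elim`. -/
theorem update_weaken {n : ℕ} {s : Fin n → Sg.Srt} (ts : ∀ i, Term T l (s i)) (i : Fin n)
    (t : Term T l (s i)) :
    (fun j => (Function.update (fun j => (ts j).subst (.weaken l (s i))) i (.bvar .zero) j).subst
      (.inst t)) = Function.update ts i t := by
  funext j
  rcases eq_or_ne j i with rfl | hj
  · simp only [Function.update_self]
    rfl
  · simp only [Function.update_of_ne hj, Term.weaken_inst]

theorem update_inCtx {n : ℕ} {s : Fin n → Sg.Srt} {ts : ∀ i, Term T l (s i)}
    (hts : ∀ i, (ts i).InCtx U) (i : Fin n) (j : Fin n) :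
    (Function.update (fun j => (ts j).subst (.weaken l (s i))) i (.bvar .zero) j).InCtx U := by
  rcases eq_or_ne j i with rfl | hj
  · simp only [Function.update_self]
    trivial
  · simp only [Function.update_of_ne hj]
    exact (hts j).subst (Substitution.weaken_maps U l _)

theorem rel_congr {θ : Formula T l} {R : Sg.Rel} {ts ts' : ∀ i, Term T l (Sg.relDom R i)}
    (h : ∀ i, Derives Th U l θ (.eq (ts i) (ts' i))) (hts : Derives Th U l θ (.rel R ts)) :
    Derives Th U l θ (.rel R ts') := by
  refine congr_family (fun ts => Derives Th U l θ (.rel R ts)) (fun ts i t hc he hR => ?_) h hts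
  have h' := eq_elim (φ := .rel R (Function.update (fun j => (ts j).subst (.weaken l _)) i
    (.bvar .zero))) (update_inCtx hc i) he
    (by simpa only [Formula.subst, update_weaken, Function.update_eq_self] using hR)
  simpa only [Formula.subst, update_weaken] using h'

theorem app_congr {θ : Formula T l} (hθ : θ.InCtx U) {f : Sg.Fn}
    {ts ts' : ∀ i, Term T l (Sg.fnDom f i)}
    (h : ∀ i, Derives Th U l θ (.eq (ts i) (ts' i))) :
    Derives Th U l θ (.eq (.app f ts) (.app f ts')) := by
  have hts₀ : (Term.app f ts).InCtx U := fun i => (h i).inCtx.2.1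
  refine congr_family (fun ts' => Derives Th U l θ (.eq (.app f ts) (.app f ts')))
    (fun ts' i t hc he hR => ?_) h (eq_rfl hθ hts₀)
  have h' := eq_elim (φ := .eq ((Term.app f ts).subst (.weaken l _))
    (.app f (Function.update (fun j => (ts' j).subst (.weaken l _)) i (.bvar .zero))))
    ⟨hts₀.subst (Substitution.weaken_maps U l _), update_inCtx hc i⟩ he
    (by
      simpa only [Formula.subst, Term.weaken_inst, Term.subst.eq_3, update_weaken,
        Function.update_eq_self] using hR)
  simpa only [Formula.subst, Term.weaken_inst, Term.subst.eq_3, update_weaken] using h'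

end Derives

end RegularLogic

/-! ### Generalised elements of subobjects in a regular category. -/

section RegularFactors

variable {S : Type w} [Category.{v} S]

/-- Lifting a strong epimorphism against the mono `A.arrow`: membership in a subobject may be
checked on a cover. -/
theorem factors_of_strongEpi_comp {P Q R : S} (A : Subobject P) (e : R ⟶ Q) [StrongEpi e]
    (f : Q ⟶ P) (h : A.Factors (e ≫ f)) : A.Factors f := by
  have sq : CommSq (A.factorThru _ h) e A.arrow f := ⟨by simp⟩
  exact (Subobject.factors_iff _ _).2 ⟨sq.lift, sq.fac_right⟩

theorem strongEpi_of_isRegularEpi {P Q : S} (e : P ⟶ Q) [IsRegularEpi e] : StrongEpi e :=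
  inferInstance

theorem mk_le_iff_factors {P Q : S} (f : Q ⟶ P) [Mono f] (B : Subobject P) :
    Subobject.mk f ≤ B ↔ B.Factors f :=
  ⟨fun h => Subobject.factors_of_le f h (Subobject.mk_factors_self f), fun h =>
    Subobject.mk_le_of_comm (B.factorThru f h) (Subobject.factorThru_arrow _ _ _)⟩

theorem subobject_le_iff {P : S} {A B : Subobject P} :
    A ≤ B ↔ ∀ (Q : S) (f : Q ⟶ P), A.Factors f → B.Factors f :=
  ⟨fun h _ f hf => Subobject.factors_of_le f h hf,
    fun h => Subobject.le_of_factors (h _ _ (Subobject.factors_self A))⟩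

variable [Regular S]

theorem exists_isRegularEpi_comp_arrow {E P : S} (g : E ⟶ P) (B : Subobject E) :
    ∃ e : (B : S) ⟶ ((Subobject.exists g).obj B : S), IsRegularEpi e ∧
      e ≫ ((Subobject.exists g).obj B).arrow = B.arrow ≫ g := by
  let F := Subobject.imageFactorisation g B
  -- The epi part of any image factorisation is strong because the regular factorisation has this
  -- property, and strong epis are regular here.
  have : StrongEpi F.F.e := strongEpi_of_strongEpiMonoFactorisation
    (Regular.strongEpiMonoFactorisation (B.arrow ≫ g)) F.isImage
  have h : IsRegularEpi F.F.e := inferInstance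
  exact ⟨F.F.e, h, F.F.fac⟩

/-- The Kripke–Joyal clause for `∃`: a generalised element is in the image iff it has a preimage
after passing to a cover. Forwards, the cover is the pullback of the one onto the image. -/
theorem exists_factors_iff {E P Q : S} (g : E ⟶ P) (B : Subobject E) (f : Q ⟶ P) :
    ((Subobject.exists g).obj B).Factors f ↔
      ∃ (R : S) (e : R ⟶ Q) (h : R ⟶ E), IsRegularEpi e ∧ B.Factors h ∧ h ≫ g = e ≫ f := by
  obtain ⟨c, hc, w⟩ := exists_isRegularEpi_comp_arrow g B
  constructor
  · intro hf
    let k := ((Subobject.exists g).obj B).factorThru f hf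
    have hk : k ≫ ((Subobject.exists g).obj B).arrow = f := Subobject.factorThru_arrow _ _ _
    refine ⟨pullback c k, pullback.snd c k, pullback.fst c k ≫ B.arrow, inferInstance,
      Subobject.factors_comp_arrow _, ?_⟩
    rw [Category.assoc, ← w, ← Category.assoc, pullback.condition, Category.assoc, hk]
  · rintro ⟨R, e, h, he, hh, hw⟩
    have := strongEpi_of_isRegularEpi e
    refine factors_of_strongEpi_comp _ e f ?_
    rw [← hw, ← Subobject.factorThru_arrow _ _ hh, Category.assoc, ← w, ← Category.assoc]
    exact Subobject.factors_comp_arrow _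

theorem equalizerSubobject_congr {P A : S} {f f' g g' : P ⟶ A} (hf : f = f') (hg : g = g') :
    equalizerSubobject f g = equalizerSubobject f' g' := by
  subst hf hg
  rfl

/-- Beck–Chevalley for the projections of a product. -/
theorem pullback_exists_fst {P Q A : S} (f : Q ⟶ P) (B : Subobject (P ⨯ A)) :
    (Subobject.pullback f).obj ((Subobject.exists (prod.fst : P ⨯ A ⟶ P)).obj B) =
      (Subobject.exists (prod.fst : Q ⨯ A ⟶ Q)).obj
        ((Subobject.pullback (prod.map f (𝟙 A))).obj B) := by
  apply le_antisymm <;> refine subobject_le_iff.2 fun R k hk => ?_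
  · rw [pullback_factors_iff, exists_factors_iff] at hk
    obtain ⟨R', e, h, he, hh, w⟩ := hk
    refine (exists_factors_iff _ _ _).2 ⟨R', e, prod.lift (e ≫ k) (h ≫ prod.snd), he, ?_,
      prod.lift_fst _ _⟩
    rw [pullback_factors_iff]
    convert hh using 1
    apply Limits.prod.hom_ext
    · rw [Category.assoc, prod.map_fst, w, ← Category.assoc]
      exact (congrArg (· ≫ f) (prod.lift_fst _ _)).trans (Category.assoc _ _ _)
    · rw [Category.assoc, prod.map_snd, Category.comp_id]
      exact prod.lift_snd _ _
  · rw [exists_factors_iff] at hk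
    obtain ⟨R', e, h, he, hh, w⟩ := hk
    rw [pullback_factors_iff] at hh ⊢
    refine (exists_factors_iff _ _ _).2 ⟨R', e, _, he, hh, ?_⟩
    simp [reassoc_of% w]

end RegularFactors

/-! ### Soundness of regular logic and of the inchworm fragment. -/

namespace Interpretation

variable {Sg : Signature.{u}} {X : Type u} {T : X → Sg.Srt}
  {S : Type w} [Category.{v} S] [Regular S] (M : Interpretation Sg S)

theorem formula_ex {U : Finset X} {l : List Sg.Srt} {A : Sg.Srt} {φ : Formula T (A :: l)}
    (h : φ.InCtx U) {P : S} (ρ : ∀ x ∈ U, P ⟶ M.obj (T x))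
    (β : ∀ B, BVar l B → (P ⟶ M.obj B)) :
    M.formula (.ex A φ) h ρ β = (Subobject.exists (prod.fst : P ⨯ M.obj A ⟶ P)).obj
      (M.formula φ h (fun x hx => prod.fst ≫ ρ x hx) (M.extend β A)) := rfl

theorem formula_congr {U : Finset X} {l : List Sg.Srt} {φ : Formula T l} (h : φ.InCtx U) {P : S}
    {ρ ρ' : ∀ x ∈ U, P ⟶ M.obj (T x)} {β β' : ∀ B, BVar l B → (P ⟶ M.obj B)}
    (hρ : ∀ x hx, ρ x hx = ρ' x hx) (hβ : ∀ B b, β B b = β' B b) :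
    M.formula φ h ρ β = M.formula φ h ρ' β' := by
  obtain rfl : ρ = ρ' := funext fun x => funext (hρ x)
  obtain rfl : β = β' := funext fun B => funext (hβ B)
  rfl

theorem comp_term {U : Finset X} {P Q : S} (f : Q ⟶ P) (ρ : ∀ x ∈ U, P ⟶ M.obj (T x))
    {l : List Sg.Srt} (β : ∀ B, BVar l B → (P ⟶ M.obj B)) {A : Sg.Srt} (t : Term T l A)
    (h : t.InCtx U) :
    f ≫ M.term ρ β t h = M.term (fun x hx => f ≫ ρ x hx) (fun B b => f ≫ β B b) t h := by
  induction t with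
  | var x => rfl
  | bvar b => rfl
  | app g ts ih =>
    simp only [term]
    rw [← Category.assoc]
    congr 1
    apply Pi.hom_ext
    intro i
    simpa using ih i (h i)

theorem extend_comp {P Q : S} (f : Q ⟶ P) {l : List Sg.Srt}
    (β : ∀ B, BVar l B → (P ⟶ M.obj B)) (A : Sg.Srt) :
    (fun B b => prod.map f (𝟙 (M.obj A)) ≫ M.extend β A B b) =
      M.extend (fun B b => f ≫ β B b) A := by
  funext B b
  cases b with
  | zero => simp [extend]
  | succ b => simp [extend]

/-- Each connective is stable under base change; the quantifier case is Beck–Chevalley. Interpreting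
over an arbitrary object `P` makes the binder case an instance of the induction hypothesis. -/
theorem pullback_formula {U : Finset X} {l : List Sg.Srt} (φ : Formula T l) (h : φ.InCtx U)
    {P Q : S} (f : Q ⟶ P) (ρ : ∀ x ∈ U, P ⟶ M.obj (T x)) (β : ∀ B, BVar l B → (P ⟶ M.obj B)) :
    (Subobject.pullback f).obj (M.formula φ h ρ β) =
      M.formula φ h (fun x hx => f ≫ ρ x hx) (fun B b => f ≫ β B b) := by
  induction φ generalizing P Q with
  | top => exact Subobject.pullback_top f
  | and φ ψ ih₁ ih₂ =>
    simp only [formula]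
    rw [Subobject.inf_pullback, ih₁, ih₂]
  | eq s t =>
    simp only [formula]
    rw [pullback_equalizer]
    exact equalizerSubobject_congr (M.comp_term _ _ _ _ _) (M.comp_term _ _ _ _ _)
  | rel R ts =>
    simp only [formula]
    rw [← Subobject.pullback_comp]
    congr 2
    apply Pi.hom_ext
    intro i
    simpa using M.comp_term f ρ β (ts i) (h i)
  | ex A φ ih =>
    have h' : φ.InCtx U := h
    rw [M.formula_ex h', M.formula_ex h', pullback_exists_fst, ih, extend_comp]
    congr 1
    refine M.formula_congr _ (fun x hx => ?_) fun _ _ => rfl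
    rw [← Category.assoc, prod.map_fst, Category.assoc]

/-- A generalised element lies in `⟦φ⟧` iff `φ` is valid at the values that it gives to the
variables. -/
theorem formula_factors_iff {U : Finset X} {l : List Sg.Srt} (φ : Formula T l) (h : φ.InCtx U)
    {P Q : S} (f : Q ⟶ P) (ρ : ∀ x ∈ U, P ⟶ M.obj (T x)) (β : ∀ B, BVar l B → (P ⟶ M.obj B)) :
    (M.formula φ h ρ β).Factors f ↔
      M.formula φ h (fun x hx => f ≫ ρ x hx) (fun B b => f ≫ β B b) = ⊤ := by
  rw [← pullback_formula, ← top_le_iff]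
  constructor
  · intro hf
    refine Subobject.le_of_factors ?_
    rw [pullback_factors_iff]
    exact Subobject.factors_of_factors_right _ hf
  · intro hf
    have := Subobject.factors_of_le (𝟙 Q) hf (Subobject.top_factors _)
    rwa [pullback_factors_iff, Category.id_comp] at this

theorem term_mono {U V : Finset X} (hUV : U ⊆ V) {P : S} (ρ : ∀ x ∈ V, P ⟶ M.obj (T x))
    {l : List Sg.Srt} (β : ∀ B, BVar l B → (P ⟶ M.obj B)) {A : Sg.Srt} (t : Term T l A)
    (h : t.InCtx U) :
    M.term ρ β t (h.mono hUV) = M.term (fun x hx => ρ x (hUV hx)) β t h := by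
  induction t with
  | var x => rfl
  | bvar b => rfl
  | app g ts ih =>
    simp only [term]
    congr 2
    funext i
    exact ih i (h i)

theorem formula_mono {U V : Finset X} (hUV : U ⊆ V) {l : List Sg.Srt} (φ : Formula T l)
    (h : φ.InCtx U) {P : S} (ρ : ∀ x ∈ V, P ⟶ M.obj (T x))
    (β : ∀ B, BVar l B → (P ⟶ M.obj B)) :
    M.formula φ (h.mono hUV) ρ β = M.formula φ h (fun x hx => ρ x (hUV hx)) β := by
  induction φ generalizing P with
  | top => rfl
  | and φ ψ ih₁ ih₂ => exact congrArg₂ _ (ih₁ h.1 _ _) (ih₂ h.2 _ _)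
  | eq s t =>
    exact equalizerSubobject_congr (M.term_mono hUV _ _ _ h.1) (M.term_mono hUV _ _ _ h.2)
  | rel R ts =>
    simp only [formula]
    congr 3
    funext i
    exact M.term_mono hUV ρ β (ts i) (h i)
  | ex A φ ih => exact congrArg _ (ih h _ _)

theorem term_rename {U : Finset X} {P : S} (ρ : ∀ x ∈ U, P ⟶ M.obj (T x))
    {l l' : List Sg.Srt} (β : ∀ B, BVar l' B → (P ⟶ M.obj B)) (r : ∀ B, BVar l B → BVar l' B)
    {A : Sg.Srt} (t : Term T l A) (h : (t.rename r).InCtx U) :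
    M.term ρ β (t.rename r) h =
      M.term ρ (fun B b => β B (r B b)) t ((Term.rename_inCtx r).1 h) := by
  induction t with
  | var x => rfl
  | bvar b => rfl
  | app g ts ih =>
    simp only [Term.rename, term]
    congr 2
    funext i
    exact ih i (h i)

theorem term_subst {U V : Finset X} {P : S} (ρ : ∀ x ∈ V, P ⟶ M.obj (T x))
    {l l' : List Sg.Srt} (β : ∀ B, BVar l' B → (P ⟶ M.obj B)) {σ : Substitution T l l'}
    (hσ : σ.Maps U V) {A : Sg.Srt} (t : Term T l A) (h : t.InCtx U) :
    M.term ρ β (t.subst σ) (h.subst hσ) =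
      M.term (fun x hx => M.term ρ β (σ.var x) (hσ.1 x hx))
        (fun B b => M.term ρ β (σ.bvar B b) (hσ.2 B b)) t h := by
  induction t with
  | var x => rfl
  | bvar b => rfl
  | app g ts ih =>
    simp only [Term.subst, term]
    congr 2
    funext i
    exact ih i (h i)

theorem formula_subst {U V : Finset X} {l : List Sg.Srt} (φ : Formula T l) (h : φ.InCtx U)
    {l' : List Sg.Srt} {σ : Substitution T l l'} (hσ : σ.Maps U V) {P : S}
    (ρ : ∀ x ∈ V, P ⟶ M.obj (T x)) (β : ∀ B, BVar l' B → (P ⟶ M.obj B)) :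
    M.formula (φ.subst σ) (h.subst hσ) ρ β =
      M.formula φ h (fun x hx => M.term ρ β (σ.var x) (hσ.1 x hx))
        (fun B b => M.term ρ β (σ.bvar B b) (hσ.2 B b)) := by
  induction φ generalizing P l' with
  | top => rfl
  | and φ ψ ih₁ ih₂ => exact congrArg₂ _ (ih₁ h.1 hσ _ _) (ih₂ h.2 hσ _ _)
  | eq s t =>
    exact equalizerSubobject_congr (M.term_subst _ _ hσ _ h.1) (M.term_subst _ _ hσ _ h.2)
  | rel R ts =>
    simp only [formula, Formula.subst]
    congr 3
    funext i
    exact M.term_subst ρ β hσ (ts i) (h i)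
  | ex A φ ih =>
    simp only [formula, Formula.subst]
    refine congrArg _ ((ih h (hσ.lift A) _ _).trans ?_)
    congr 1
    · funext x hx
      exact (M.term_rename _ _ _ _ _).trans (M.comp_term _ _ _ _ _).symm
    · funext B b
      cases b with
      | zero => rfl
      | succ b => exact (M.term_rename _ _ _ _ _).trans (M.comp_term _ _ _ _ _).symm

theorem formula_weaken {U : Finset X} {l : List Sg.Srt} {A : Sg.Srt} (φ : Formula T l)
    (h : φ.InCtx U) {P : S} (ρ : ∀ x ∈ U, P ⟶ M.obj (T x))
    (β : ∀ B, BVar (A :: l) B → (P ⟶ M.obj B)) :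
    M.formula (φ.weaken A) (Formula.weaken_inCtx.2 h) ρ β =
      M.formula φ h ρ (fun B b => β B (.succ b)) :=
  M.formula_subst φ h (Substitution.weaken_maps U l A) ρ β

/-- The arrow to the object interpreting a context that has the given components. -/
noncomputable def ctxLift {U : Finset X} {P : S} (ρ : ∀ x ∈ U, P ⟶ M.obj (T x)) :
    (l : List Sg.Srt) → (∀ B, BVar l B → (P ⟶ M.obj B)) → (P ⟶ M.fullCtx T U l)
  | [], _ => Pi.lift fun x => ρ x.1 x.2
  | A :: l, β => prod.lift (ctxLift ρ l fun B b => β B (.succ b)) (β A .zero)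

theorem ctxLift_namedProj {U : Finset X} {P : S} (ρ : ∀ x ∈ U, P ⟶ M.obj (T x))
    (l : List Sg.Srt) (β : ∀ B, BVar l B → (P ⟶ M.obj B)) (x : X) (hx : x ∈ U) :
    M.ctxLift ρ l β ≫ M.namedProj U l x hx = ρ x hx := by
  induction l with
  | nil => exact Pi.lift_π _ _
  | cons A l ih =>
    exact (prod.lift_fst_assoc _ _ _).trans (ih _)

theorem ctxLift_namelessProj {U : Finset X} {P : S} (ρ : ∀ x ∈ U, P ⟶ M.obj (T x))
    (l : List Sg.Srt) (β : ∀ B, BVar l B → (P ⟶ M.obj B)) (B : Sg.Srt) (b : BVar l B) :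
    M.ctxLift ρ l β ≫ M.namelessProj T U l B b = β B b := by
  induction b with
  | zero => exact prod.lift_snd _ _
  | succ b ih =>
    exact (prod.lift_fst_assoc _ _ _).trans (ih _)

/-- The object of a context is the universal case, so the single inequality that `IsModel` requires
there yields validity at every `P`. -/
theorem pullback_interp {U : Finset X} {l : List Sg.Srt} (φ : Formula T l) (h : φ.InCtx U)
    {P : S} (ρ : ∀ x ∈ U, P ⟶ M.obj (T x)) (β : ∀ B, BVar l B → (P ⟶ M.obj B)) :
    (Subobject.pullback (M.ctxLift ρ l β)).obj (M.interp U φ h) = M.formula φ h ρ β := by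
  rw [interp, pullback_formula]
  congr 1
  · funext x hx
    exact M.ctxLift_namedProj ρ l β x hx
  · funext B b
    exact M.ctxLift_namelessProj ρ l β B b

variable {M}

theorem IsModel.sound {Th : Set (Sequent T)} (hM : M.IsModel Th) {U : Finset X}
    {l : List Sg.Srt} {φ ψ : Formula T l} (d : Derives Th U l φ ψ) (hφ : φ.InCtx U)
    (hψ : ψ.InCtx U) {P : S} (ρ : ∀ x ∈ U, P ⟶ M.obj (T x))
    (β : ∀ B, BVar l B → (P ⟶ M.obj B)) : M.formula φ hφ ρ β ≤ M.formula ψ hψ ρ β := by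
  induction d generalizing P with
  | ax s hs =>
    rw [← pullback_interp, ← pullback_interp]
    exact (Subobject.pullback _).monotone (hM s hs)
  | id _ => exact le_rfl
  | cut d₁ _ ih₁ ih₂ => exact (ih₁ hφ d₁.inCtx.2 ρ β).trans (ih₂ d₁.inCtx.2 hψ ρ β)
  | subst σ hσ d ih =>
    rw [M.formula_subst _ d.inCtx.1 hσ, M.formula_subst _ d.inCtx.2 hσ]
    exact ih _ _ _ _
  | top _ => exact le_top
  | and_left _ _ => exact inf_le_left
  | and_right _ _ => exact inf_le_right
  | and_intro _ _ ih₁ ih₂ => exact le_inf (ih₁ hφ hψ.1 ρ β) (ih₂ hφ hψ.2 ρ β)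
  | eq_refl _ =>
    simp only [formula]
    rw [equalizerSubobject_of_self]
  | @eq_subst U l A s t φ hs ht h =>
    refine subobject_le_iff.2 fun Q f hf => ?_
    simp only [formula] at hf
    rw [Subobject.inf_factors, equalizerSubobject_factors_iff, formula_factors_iff,
      M.formula_subst _ h (Substitution.inst_maps hs)] at hf
    rw [formula_factors_iff, M.formula_subst _ h (Substitution.inst_maps ht), ← hf.2]
    -- Over `Q` the values of `s` and `t` coincide, so the two instances of `φ` are read at the same
    -- assignment.
    congr 1
    funext B b
    cases b with
    | zero =>
      refine (M.comp_term f ρ β t ht).symm.trans ?_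
      exact hf.1.symm.trans (M.comp_term f ρ β s hs)
    | succ b => rfl
  | @ex_left U l A φ ψ d ih =>
    simp only [formula]
    refine ((Subobject.existsPullbackAdj _).homEquiv _ _).symm (homOfLE ?_) |>.le
    rw [pullback_formula]
    refine (ih hφ (Formula.weaken_inCtx.2 hψ) _ _).trans (le_of_eq ?_)
    exact M.formula_weaken _ _ _ _
  | @ex_right U l A φ ψ d ih =>
    have h := ih hφ (Formula.weaken_inCtx.1 hψ) ρ (fun B b => β B (.succ b))
    rw [M.formula_weaken _ (Formula.weaken_inCtx.1 hψ)]
    refine le_trans ?_ h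
    refine subobject_le_iff.2 fun Q f hf => ?_
    rw [M.formula_ex hφ]
    -- The value that `β` gives to the newest variable is itself a witness, so the trivial cover
    -- suffices.
    refine (exists_factors_iff _ _ _).2 ⟨Q, 𝟙 Q, prod.lift f (f ≫ β A .zero), inferInstance, ?_,
      (prod.lift_fst _ _).trans (Category.id_comp f).symm⟩
    rw [formula_factors_iff] at hf ⊢
    rw [← hf]
    refine M.formula_congr _ (fun x hx => ?_) fun B b => ?_
    · exact prod.lift_fst_assoc _ _ _
    · cases b with
      | zero => exact prod.lift_snd _ _
      | succ b => exact prod.lift_fst_assoc _ _ _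
  | @frobenius U l A φ ψ h₁ h₂ =>
    simp only [formula]
    rw [M.formula_weaken _ h₁, inf_comm, ← Regular.exists_inf_pullback_eq_exists_inf,
      pullback_formula, inf_comm]
    exact le_rfl

theorem formula_conj_factors {U : Finset X} {l : List Sg.Srt} {Δ : List (Formula T l)}
    (hΔ : (Formula.conj Δ).InCtx U) {P Q : S} (ρ : ∀ x ∈ U, P ⟶ M.obj (T x))
    (β : ∀ B, BVar l B → (P ⟶ M.obj B)) (f : Q ⟶ P) :
    (M.formula _ hΔ ρ β).Factors f ↔
      ∀ φ (hφ : φ ∈ Δ), (M.formula φ (Formula.conj_inCtx.1 hΔ φ hφ) ρ β).Factors f := by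
  induction Δ with
  | nil => simp [Formula.conj, formula, Subobject.top_factors]
  | cons φ Δ ih =>
    simp only [Formula.conj, formula]
    rw [Subobject.inf_factors, ih]
    constructor
    · rintro ⟨h₁, h₂⟩ ψ hψ
      rcases List.mem_cons.1 hψ with rfl | h
      · exact h₁
      · exact h₂ ψ h
    · exact fun h => ⟨h φ (by simp), fun ψ hψ => h ψ (by simp [hψ])⟩

variable (M T) in
/-- The projection `F_V ⟶ F_U` for `U ⊆ V`. -/
noncomputable def restr {U V : Finset X} (hUV : U ⊆ V) : M.ctx T V ⟶ M.ctx T U :=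
  Pi.lift fun x : {x // x ∈ U} => Pi.π (fun x : {x // x ∈ V} => M.obj (T x)) ⟨x.1, hUV x.2⟩

theorem phi_mono {U V : Finset X} (hUV : U ⊆ V) (φ : Formula T []) (h : φ ∈ Phi T U) :
    M.phi V φ (h.mono hUV) = (Subobject.pullback (M.restr T hUV)).obj (M.phi U φ h) := by
  have h₁ := M.pullback_formula φ h (M.restr T hUV) (M.namedProj U []) (M.namelessProj T U [])
  refine (M.formula_mono hUV φ h _ _).trans (Eq.trans ?_ h₁.symm)
  refine M.formula_congr h (fun x hx => (Pi.lift_π (fun x : {x // x ∈ U} =>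
    Pi.π (fun x : {x // x ∈ V} => M.obj (T x)) ⟨x.1, hUV x.2⟩) ⟨x, hx⟩).symm) fun B b => nomatch b

variable {C : ContextComplex X} {A : C.Faceᵒᵖ ⥤ S} (ι : A ⟶ M.sheaf T C)

/-- The component at `U` of an arrow into the sheaf `F`, as an arrow into `F_U`. -/
def component (U : C.Face) : A.obj (op U) ⟶ M.ctx T U.1 := ι.app (op U)

theorem map_component {U V : C.Face} (f : op V ⟶ op U) :
    A.map f ≫ component ι U = component ι V ≫ M.restr T f.unop.le :=
  ι.naturality _

theorem models_iff [Mono ι] (φ : Formula T []) :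
    Models ι φ ↔ ∀ (U : C.Face) (h : φ ∈ Phi T U.1), (M.phi U.1 φ h).Factors (component ι U) :=
  forall₂_congr fun U h => mk_le_iff_factors (ι.app (op U)) (M.phi U.1 φ h)

theorem phi_factors_mono {U V : Finset X} (hUV : U ⊆ V) {φ : Formula T []} (h : φ ∈ Phi T U)
    (hV : φ ∈ Phi T V) {P : S} (f : P ⟶ M.ctx T V) :
    (M.phi V φ hV).Factors f ↔ (M.phi U φ h).Factors (f ≫ M.restr T hUV) := by
  rw [phi_mono hUV φ h, pullback_factors_iff]

/-- Descend from `U` to `U ∩ V` along the regular epi restriction, then pull back to `V`. This is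
the only use of no-signalling in the soundness half. -/
theorem models_of_face [Mono ι] (hA : NoSignalling A) {φ : Formula T []} (U : C.Face)
    (h : φ ∈ Phi T U.1) (hU : (M.phi U.1 φ h).Factors (component ι U)) : Models ι φ := by
  classical
  refine (models_iff ι φ).2 fun V hV => ?_
  let W : C.Face := ⟨U.1 ∩ V.1, C.down_closed U.2 Finset.inter_subset_left⟩
  let f : op U ⟶ op W := (homOfLE (Finset.inter_subset_left : U.1 ∩ V.1 ⊆ U.1)).op
  let g : op V ⟶ op W := (homOfLE (Finset.inter_subset_right : U.1 ∩ V.1 ⊆ V.1)).op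
  have hφW : φ ∈ Phi T W.1 := Formula.InCtx.inter h hV
  have := hA f
  have := strongEpi_of_isRegularEpi (A.map f)
  have hW : (M.phi W.1 φ hφW).Factors (component ι W) := by
    refine factors_of_strongEpi_comp _ (A.map f) _ ?_
    rw [map_component]
    exact (phi_factors_mono f.unop.le hφW h _).1 hU
  rw [phi_factors_mono g.unop.le hφW hV, ← map_component ι g]
  exact Subobject.factors_of_factors_right _ hW

theorem models_of_inchworm [Mono ι] {Th : Set (Sequent T)} (hM : M.IsModel Th)
    (hA : NoSignalling A) {Γ : Set (Formula T [])} {φ : Formula T []} (h : C.Inchworm Th Γ φ)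
    (hΓ : ∀ ψ ∈ Γ, Models ι ψ) : Models ι φ := by
  induction h with
  | @base Γ φ U hU hφ h =>
    obtain ⟨Δ, hΔ, d⟩ := h
    refine models_of_face ι hA ⟨U, hU⟩ hφ
      (Subobject.factors_of_le _ (hM.sound d d.inCtx.1 hφ _ _) ?_)
    refine (formula_conj_factors d.inCtx.1 _ _ _).2 fun ψ hψ => ?_
    exact (models_iff ι ψ).1 (hΓ ψ (hΔ ψ hψ).1) ⟨U, hU⟩ (hΔ ψ hψ).2
  | cut _ _ ih₁ ih₂ =>
    refine ih₂ fun ψ hψ => ?_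
    rcases hψ with rfl | hψ
    · exact ih₁ fun χ hχ => hΓ χ (Or.inl hχ)
    · exact hΓ ψ (Or.inr hψ)

end Interpretation

/-! ### Assignments and set-valued structures. -/

/-- The assignment `β` extended by the value `a` for the most recent nameless variable. -/
def BVar.cons {B : Type u} {F : B → Type v} {A : B} {l : List B} (a : F A)
    (β : ∀ B, BVar l B → F B) : ∀ B, BVar (A :: l) B → F B
  | _, .zero => a
  | B, .succ b => β B b

theorem BVar.finite {B : Type u} (l : List B) : Finite (Σ A, BVar l A) := by
  induction l with
  | nil => exact @Finite.of_subsingleton _ ⟨fun a => nomatch a.2⟩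
  | cons A l ih =>
    refine Finite.of_surjective (α := Option (Σ A, BVar l A)) (fun o => match o with
      | none => ⟨A, .zero⟩
      | some b => ⟨b.1, .succ b.2⟩) ?_
    rintro ⟨_, b⟩
    cases b with
    | zero => exact ⟨none, rfl⟩
    | succ b => exact ⟨some ⟨_, b⟩, rfl⟩

/-- Finite tuples are assignments to suitable lists of nameless variables. -/
theorem BVar.exists_tuple {B : Type u} {n : ℕ} (s : Fin n → B) :
    ∃ (l : List B) (b : ∀ i, BVar l (s i)), ∀ (F : B → Type u) (a : ∀ i, F (s i)),
      ∃ β : ∀ B, BVar l B → F B, ∀ i, β _ (b i) = a i := by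
  induction n with
  | zero => exact ⟨[], fun i => i.elim0, fun F a => ⟨fun _ b => (nomatch b), fun i => i.elim0⟩⟩
  | succ n ih =>
    obtain ⟨l, b, h⟩ := ih fun i => s i.succ
    refine ⟨s 0 :: l, Fin.cons .zero fun i => .succ (b i), fun F a => ?_⟩
    obtain ⟨β, hβ⟩ := h F fun i => a i.succ
    refine ⟨BVar.cons (a 0) β, fun i => ?_⟩
    refine Fin.cases rfl (fun i => ?_) i
    exact hβ i

/-- A structure for a many-sorted signature, in the sense of classical model theory. -/
structure SetStructure (Sg : Signature.{u}) where
  carrier : Sg.Srt → Type u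
  fn : (f : Sg.Fn) → (∀ i, carrier (Sg.fnDom f i)) → carrier (Sg.fnCod f)
  rel : (R : Sg.Rel) → (∀ i, carrier (Sg.relDom R i)) → Prop

namespace SetStructure

variable {Sg : Signature.{u}} {X : Type u} {T : X → Sg.Srt} (M : SetStructure Sg)

/-- The value of a term. -/
def eval {V : Finset X} (ρ : ∀ x ∈ V, M.carrier (T x)) {l : List Sg.Srt}
    (β : ∀ B, BVar l B → M.carrier B) : {A : Sg.Srt} → (t : Term T l A) → t.InCtx V → M.carrier A
  | _, .var x, h => ρ x h
  | _, .bvar b, _ => β _ b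
  | _, .app f ts, h => M.fn f fun i => eval ρ β (ts i) (h i)

/-- Satisfaction of a formula. -/
def Sat {V : Finset X} (ρ : ∀ x ∈ V, M.carrier (T x)) : {l : List Sg.Srt} →
    (φ : Formula T l) → φ.InCtx V → (∀ B, BVar l B → M.carrier B) → Prop
  | _, .top, _, _ => True
  | _, .and φ ψ, h, β => Sat ρ φ h.1 β ∧ Sat ρ ψ h.2 β
  | _, .eq s t, h, β => M.eval ρ β s h.1 = M.eval ρ β t h.2
  | _, .rel R ts, h, β => M.rel R fun i => M.eval ρ β (ts i) (h i)
  | _, .ex A φ, h, β => ∃ a : M.carrier A, Sat ρ φ h (BVar.cons a β)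

/-- The structure satisfies all sequents in `Th`. -/
def IsModel (Th : Set (Sequent T)) : Prop :=
  ∀ s ∈ Th, ∀ (ρ : ∀ x ∈ s.U, M.carrier (T x)) (β : ∀ B, BVar s.l B → M.carrier B),
    M.Sat ρ s.lhs s.lhs_inCtx β → M.Sat ρ s.rhs s.rhs_inCtx β

end SetStructure

/-! ### Completeness of regular logic for set models, by forcing with conservative stages. -/

section Completeness

variable {Sg : Signature.{u}} {X : Type u} {T : X → Sg.Srt}

/-- The unique substitution for the empty list of nameless variables that fixes the named ones. -/
def Substitution.ofNil (T : X → Sg.Srt) (l : List Sg.Srt) : Substitution T [] l where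
  var x := .var x
  bvar _ b := nomatch b

theorem Formula.subst_ofNil_nil (φ : Formula T []) : φ.subst (.ofNil T []) = φ := by
  refine Eq.trans ?_ φ.subst_ident
  congr 1
  exact Substitution.ext_of (fun _ => rfl) fun _ b => nomatch b

theorem Formula.subst_ofNil_subst (φ : Formula T []) {l l' : List Sg.Srt}
    {r : Substitution T l l'} (hr : ∀ x, r.var x = .var x) :
    (φ.subst (.ofNil T l)).subst r = φ.subst (.ofNil T l') := by
  rw [Formula.subst_subst]
  congr 1
  exact Substitution.ext_of hr fun _ b => nomatch b

theorem Substitution.cons_comp {l l' l'' : List Sg.Srt} {A : Sg.Srt} (t : Term T l' A)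
    (σ : Substitution T l l') (τ : Substitution T l' l'') :
    (cons t σ).comp τ = cons (t.subst τ) (σ.comp τ) := by
  refine Substitution.ext_of (fun _ => rfl) fun B b => ?_
  cases b <;> rfl

theorem Substitution.lift_eq_cons {l l' : List Sg.Srt} (σ : Substitution T l l') (A : Sg.Srt) :
    σ.lift A = .cons (.bvar .zero) (σ.comp (.weaken l' A)) := by
  refine Substitution.ext_of (fun x => Term.rename_succ _) fun B b => ?_
  cases b with
  | zero => rfl
  | succ b => exact Term.rename_succ _

/-- Names for elements of the canonical model: the named variables, and for every existential
formula, at all names for its parameters, a name for a witness. -/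
inductive WitnessName {Sg : Signature.{u}} {X : Type u} (T : X → Sg.Srt) : Sg.Srt → Type u
  | base (x : X) : WitnessName T (T x)
  | wit {V : Finset X} {l : List Sg.Srt} {A : Sg.Srt} (φ : Formula T (A :: l))
      (ρ : ∀ x ∈ V, WitnessName T (T x)) (β : ∀ B, BVar l B → WitnessName T B) : WitnessName T A

/-- The partial valuation `val` of the names sends the parameters `ρ`, `β` to the terms of `σ`. -/
def Realizes {l' : List Sg.Srt} (val : (a : Σ A, WitnessName T A) → Option (Term T l' a.1))
    {V : Finset X} {l : List Sg.Srt} (ρ : ∀ x ∈ V, WitnessName T (T x))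
    (β : ∀ B, BVar l B → WitnessName T B) (σ : Substitution T l l') : Prop :=
  (∀ x hx, val ⟨_, ρ x hx⟩ = some (σ.var x)) ∧ ∀ B b, val ⟨B, β B b⟩ = some (σ.bvar B b)

/-- A stage of the construction of the canonical model of `δ`: a formula over `δ` in a context of
additional nameless variables that is conservative over `δ`, and a partial valuation of the names
by terms in which every named witness is a witness. -/
structure Stage (Th : Set (Sequent T)) (U : Finset X) (δ : Formula T []) where
  l : List Sg.Srt
  θ : Formula T l
  val : (a : Σ A, WitnessName T A) → Option (Term T l a.1)
  val_inCtx : ∀ a t, val a = some t → t.InCtx U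
  val_base : ∀ x ∈ U, val ⟨T x, .base x⟩ = some (.var x)
  val_wit : ∀ (V : Finset X) (l' : List Sg.Srt) (A : Sg.Srt) (φ : Formula T (A :: l'))
    (ρ : ∀ x ∈ V, WitnessName T (T x)) (β : ∀ B, BVar l' B → WitnessName T B) (t : Term T l A),
    val ⟨A, .wit φ ρ β⟩ = some t →
      ∃ σ, Realizes val ρ β σ ∧ Derives Th U l θ (φ.subst (.cons t σ))
  derives : Derives Th U l θ (δ.subst (.ofNil T l))
  conservative : ∀ χ : Formula T [], χ.InCtx U → Derives Th U l θ (χ.subst (.ofNil T l)) →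
    Derives Th U [] δ χ

namespace Stage

variable {Th : Set (Sequent T)} {U : Finset X} {δ : Formula T []}

/-- The stage `q` extends the stage `p` along the substitution `r`. -/
structure Extends (p q : Stage Th U δ) (r : Substitution T p.l q.l) : Prop where
  maps : r.Maps U U
  var : ∀ x, r.var x = .var x
  val : ∀ a t, p.val a = some t → q.val a = some (t.subst r)
  derives : Derives Th U q.l q.θ (p.θ.subst r)

/-- Larger stages know more. Directedness is never needed. -/
instance : Preorder (Stage Th U δ) where
  le p q := ∃ r, Extends p q r
  le_refl p := ⟨.ident T p.l, Substitution.ident_maps _ _, fun _ => rfl,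
    fun a t h => by rw [Term.subst_ident, h],
    by rw [Formula.subst_ident]; exact .id p.derives.inCtx.1⟩
  le_trans := by
    rintro p q s ⟨r, hr⟩ ⟨r', hr'⟩
    refine ⟨r.comp r', hr.maps.comp hr'.maps, fun x => ?_, fun a t h => ?_, ?_⟩
    · simp only [Substitution.comp, hr.var]
      exact hr'.var x
    · rw [← Term.subst_subst]
      exact hr'.val _ _ (hr.val _ _ h)
    · rw [← Formula.subst_subst]
      exact hr'.derives.cut (.subst r' hr'.maps hr.derives)

theorem θ_inCtx (p : Stage Th U δ) : p.θ.InCtx U := p.derives.inCtx.1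

/-- The initial stage. -/
noncomputable def initial (hδ : δ.InCtx U) : Stage Th U δ where
  l := []
  θ := δ
  val a := open Classical in match a with
    | ⟨_, .base x⟩ => if x ∈ U then some (.var x) else none
    | ⟨_, .wit _ _ _⟩ => none
  val_inCtx := by
    rintro ⟨_, a⟩ t h
    cases a with
    | base x =>
      dsimp only at h
      split at h
      · obtain rfl := Option.some.inj h
        assumption
      · simp at h
    | wit φ ρ β => simp at h
  val_base x hx := by simp [hx]
  val_wit V l' A φ ρ β t h := by simp at h
  derives := by
    rw [Formula.subst_ofNil_nil]
    exact .id hδ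
  conservative χ _ h := by rwa [Formula.subst_ofNil_nil] at h

variable {V : Finset X} {l : List Sg.Srt} {ρ : ∀ x ∈ V, WitnessName T (T x)}
  {β : ∀ B, BVar l B → WitnessName T B}

theorem realizes_of_extends {p q : Stage Th U δ} {r : Substitution T p.l q.l}
    (h : Extends p q r) {σ : Substitution T l p.l} (hσ : Realizes p.val ρ β σ) :
    Realizes q.val ρ β (σ.comp r) :=
  ⟨fun x hx => h.val _ _ (hσ.1 x hx), fun B b => h.val _ _ (hσ.2 B b)⟩

theorem maps_of_realizes {p : Stage Th U δ} {σ : Substitution T l p.l}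
    (hσ : Realizes p.val ρ β σ) : σ.Maps V U :=
  ⟨fun x hx => p.val_inCtx _ _ (hσ.1 x hx), fun B b => p.val_inCtx _ _ (hσ.2 B b)⟩

/-- A name has at most one value at a stage, so facts about the same parameters that were obtained
separately can be combined. -/
theorem agree_of_realizes {p : Stage Th U δ} {σ τ : Substitution T l p.l}
    (hσ : Realizes p.val ρ β σ) (hτ : Realizes p.val ρ β τ) : Substitution.Agree V σ τ :=
  ⟨fun x hx => Option.some.inj ((hσ.1 x hx).symm.trans (hτ.1 x hx)),
    fun B b => Option.some.inj ((hσ.2 B b).symm.trans (hτ.2 B b))⟩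

open Classical in
/-- The valuation `val`, with the most recent variable as a new value for the name `b`. -/
noncomputable def extendVal {l : List Sg.Srt} {A : Sg.Srt}
    (val : (a : Σ A, WitnessName T A) → Option (Term T l a.1)) (b : WitnessName T A) :
    (a : Σ A, WitnessName T A) → Option (Term T (A :: l) a.1) :=
  Function.update (fun a => (val a).map fun t => t.subst (.weaken l A)) ⟨A, b⟩
    (some (.bvar .zero))

open Classical in
theorem extendVal_self {l : List Sg.Srt} {A : Sg.Srt}
    (val : (a : Σ A, WitnessName T A) → Option (Term T l a.1)) (b : WitnessName T A) :
    extendVal val b ⟨A, b⟩ = some (.bvar .zero) :=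
  Function.update_self _ _ _

open Classical in
theorem extendVal_of_ne {l : List Sg.Srt} {A : Sg.Srt}
    (val : (a : Σ A, WitnessName T A) → Option (Term T l a.1)) (b : WitnessName T A)
    {a : Σ A, WitnessName T A} (h : a ≠ ⟨A, b⟩) :
    extendVal val b a = (val a).map fun t => t.subst (.weaken l A) :=
  Function.update_of_ne h _ _

theorem extendVal_of_eq_some {l : List Sg.Srt} {A : Sg.Srt}
    {val : (a : Σ A, WitnessName T A) → Option (Term T l a.1)} {b : WitnessName T A}
    (hb : val ⟨A, b⟩ = none) (a : Σ A, WitnessName T A) (t : Term T l a.1) (ha : val a = some t) :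
    extendVal val b a = some (t.subst (.weaken l A)) := by
  rw [extendVal_of_ne, ha, Option.map_some]
  rintro rfl
  simp [hb] at ha

/-- The stage `p` extended by a new variable, as a value for the name of a witness. -/
noncomputable def extendWit (p : Stage Th U δ) {A : Sg.Srt} {φ : Formula T (A :: l)}
    {σ : Substitution T l p.l} (hσ : Realizes p.val ρ β σ)
    (h : Derives Th U p.l p.θ ((Formula.ex A φ).subst σ))
    (hn : p.val ⟨A, .wit φ ρ β⟩ = none) : Stage Th U δ :=
  let val := extendVal p.val (.wit φ ρ β)
  have hval : ∀ a t, p.val a = some t → val a = some (t.subst (.weaken p.l A)) :=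
    extendVal_of_eq_some hn
  have hval' : ∀ a, a ≠ ⟨A, .wit φ ρ β⟩ → ∀ t, val a = some t →
      ∃ t', p.val a = some t' ∧ t'.subst (.weaken p.l A) = t := by
    intro a hne t ha
    simpa only [val, extendVal_of_ne _ _ hne, Option.map_eq_some_iff] using ha
  have hreal : ∀ {V : Finset X} {l : List Sg.Srt} {ρ : ∀ x ∈ V, WitnessName T (T x)}
      {β : ∀ B, BVar l B → WitnessName T B} {σ : Substitution T l p.l},
      Realizes p.val ρ β σ → Realizes val ρ β (σ.comp (.weaken p.l A)) :=
    fun hσ => ⟨fun x hx => hval _ _ (hσ.1 x hx), fun B b => hval _ _ (hσ.2 B b)⟩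
  have hθ : (p.θ.weaken A).InCtx U := Formula.weaken_inCtx.2 p.θ_inCtx
  have hφ : (φ.subst (σ.lift A)).InCtx U := h.inCtx.2
  { l := A :: p.l
    θ := .and (p.θ.weaken A) (φ.subst (σ.lift A))
    val := val
    val_inCtx := by
      intro a t ha
      by_cases hne : a = ⟨A, .wit φ ρ β⟩
      · subst hne
        simp only [val, extendVal_self] at ha
        obtain rfl := Option.some.inj ha
        trivial
      · obtain ⟨t', ht', rfl⟩ := hval' a hne t ha
        exact (p.val_inCtx _ _ ht').subst (Substitution.weaken_maps U _ _)
    val_base := fun x hx => hval _ _ (p.val_base x hx)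
    val_wit := by
      intro V' l' A' φ' ρ' β' t ha
      -- The new name has the new variable as its value, and the new conjunct of `θ` says that it is
      -- a witness. Older names keep their weakened witnesses.
      by_cases hne : (⟨A', .wit φ' ρ' β'⟩ : Σ A, WitnessName T A) = ⟨A, .wit φ ρ β⟩
      · cases hne
        simp only [val, extendVal_self] at ha
        obtain rfl := Option.some.inj ha
        refine ⟨_, hreal hσ, ?_⟩
        rw [← Substitution.lift_eq_cons]
        exact .and_right hθ hφ
      · obtain ⟨t', ht', rfl⟩ := hval' _ hne t ha
        obtain ⟨σ', hσ', d⟩ := p.val_wit _ _ _ _ _ _ _ ht'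
        refine ⟨_, hreal hσ', (Derives.and_left hθ hφ).cut ?_⟩
        have d' := d.subst (.weaken p.l A) (Substitution.weaken_maps U _ _)
        rw [Formula.subst_subst] at d'
        rwa [Substitution.cons_comp] at d'
    derives := by
      refine (Derives.and_left hθ hφ).cut ?_
      have d := p.derives.subst (.weaken p.l A) (Substitution.weaken_maps U _ _)
      rwa [Formula.subst_ofNil_subst _ fun _ => rfl] at d
    conservative := by
      intro χ hχ d
      refine p.conservative χ hχ ?_
      rw [← Formula.subst_ofNil_subst χ (r := .weaken p.l A) fun _ => rfl] at d
      -- As `θ` proves `∃ φ`, Frobenius gives `θ ⊢ ∃ (θ ∧ φ)`, and `χ` does not mention the new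
      -- variable.
      exact (Derives.and_intro (.id p.θ_inCtx) h).cut
        ((Derives.frobenius p.θ_inCtx hφ).cut (.ex_left d)) }

theorem extends_extendWit (p : Stage Th U δ) {A : Sg.Srt} {φ : Formula T (A :: l)}
    {σ : Substitution T l p.l} (hσ : Realizes p.val ρ β σ)
    (h : Derives Th U p.l p.θ ((Formula.ex A φ).subst σ))
    (hn : p.val ⟨A, .wit φ ρ β⟩ = none) :
    Extends p (p.extendWit hσ h hn) (.weaken p.l A) where
  maps := Substitution.weaken_maps U _ _
  var _ := rfl
  val := extendVal_of_eq_some hn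
  derives := .and_left (Formula.weaken_inCtx.2 p.θ_inCtx) h.inCtx.2

theorem val_extendWit (p : Stage Th U δ) {A : Sg.Srt} {φ : Formula T (A :: l)}
    {σ : Substitution T l p.l} (hσ : Realizes p.val ρ β σ)
    (h : Derives Th U p.l p.θ ((Formula.ex A φ).subst σ))
    (hn : p.val ⟨A, .wit φ ρ β⟩ = none) :
    (p.extendWit hσ h hn).val ⟨A, .wit φ ρ β⟩ = some (.bvar .zero) :=
  extendVal_self _ _

/-- A property that can be achieved at an extension of every stage. -/
def Forced (P : Stage Th U δ → Prop) : Prop := ∀ p, ∃ q, p ≤ q ∧ P q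

theorem Forced.imp {P Q : Stage Th U δ → Prop} (h : Forced P) (hPQ : ∀ p, P p → Q p) : Forced Q :=
  fun p => (h p).imp fun _ hq => ⟨hq.1, hPQ _ hq.2⟩

/-- Achieve `P`, then `Q` further up; `P` persists. Hence only `P` has to be monotone. -/
theorem Forced.and {P Q : Stage Th U δ → Prop} (hP : Forced P) (hm : Monotone P)
    (hQ : Forced Q) : Forced fun p => P p ∧ Q p := by
  intro p
  obtain ⟨q, hpq, hq⟩ := hP p
  obtain ⟨s, hqs, hs⟩ := hQ q
  exact ⟨s, hpq.trans hqs, hm hqs hq, hs⟩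

theorem Forced.forall {ι : Type*} [Finite ι] {P : ι → Stage Th U δ → Prop}
    (h : ∀ i, Forced (P i)) (hm : ∀ i, Monotone (P i)) : Forced fun p => ∀ i, P i p := by
  classical
  have := Fintype.ofFinite ι
  have key : ∀ S : Finset ι, Forced fun p => ∀ i ∈ S, P i p := by
    intro S
    induction S using Finset.induction_on with
    | empty => exact fun p => ⟨p, le_rfl, by simp⟩
    | insert i S _ ih =>
      refine ((h i).and (hm i) ih).imp fun p hp j hj => ?_
      rcases Finset.mem_insert.1 hj with rfl | hj
      · exact hp.1
      · exact hp.2 j hj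
  exact (key Finset.univ).imp fun p hp i => hp i (Finset.mem_univ i)

/-- The name has a value at the stage. -/
def Defined {A : Sg.Srt} (a : WitnessName T A) (p : Stage Th U δ) : Prop :=
  ∃ t, p.val ⟨A, a⟩ = some t

/-- The formula holds of the names at the stage. -/
def Holds (φ : Formula T l) (ρ : ∀ x ∈ V, WitnessName T (T x))
    (β : ∀ B, BVar l B → WitnessName T B) (p : Stage Th U δ) : Prop :=
  ∃ σ, Realizes p.val ρ β σ ∧ Derives Th U p.l p.θ (φ.subst σ)

/-- The names are provably equal at the stage. -/
def EqHolds {A : Sg.Srt} (a b : WitnessName T A) (p : Stage Th U δ) : Prop :=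
  ∃ s t, p.val ⟨A, a⟩ = some s ∧ p.val ⟨A, b⟩ = some t ∧ Derives Th U p.l p.θ (.eq s t)

/-- The name is provably the value of the term at the stage. -/
def EvalHolds {A : Sg.Srt} (t : Term T l A) (ρ : ∀ x ∈ V, WitnessName T (T x))
    (β : ∀ B, BVar l B → WitnessName T B) (a : WitnessName T A) (p : Stage Th U δ) : Prop :=
  ∃ σ s, Realizes p.val ρ β σ ∧ p.val ⟨A, a⟩ = some s ∧
    Derives Th U p.l p.θ (.eq s (t.subst σ))

/-- The name is provably the value of the function at the stage. -/
def AppHolds (f : Sg.Fn) (as : ∀ i, WitnessName T (Sg.fnDom f i)) (a : WitnessName T (Sg.fnCod f))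
    (p : Stage Th U δ) : Prop :=
  ∃ ts s, (∀ i, p.val ⟨_, as i⟩ = some (ts i)) ∧ p.val ⟨_, a⟩ = some s ∧
    Derives Th U p.l p.θ (.eq s (.app f ts))

/-- The relation provably holds of the names at the stage. -/
def RelHolds (R : Sg.Rel) (as : ∀ i, WitnessName T (Sg.relDom R i)) (p : Stage Th U δ) : Prop :=
  ∃ ts, (∀ i, p.val ⟨_, as i⟩ = some (ts i)) ∧ Derives Th U p.l p.θ (.rel R ts)

theorem derives_of_extends {p q : Stage Th U δ} {r : Substitution T p.l q.l} (h : Extends p q r)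
    {φ : Formula T p.l} (d : Derives Th U p.l p.θ φ) : Derives Th U q.l q.θ (φ.subst r) :=
  h.derives.cut (d.subst r h.maps)

theorem defined_mono {A : Sg.Srt} (a : WitnessName T A) :
    Monotone (Defined (Th := Th) (U := U) (δ := δ) a) := by
  rintro p q ⟨r, hr⟩ ⟨t, ht⟩
  exact ⟨_, hr.val _ _ ht⟩

theorem holds_mono (φ : Formula T l) :
    Monotone (Holds (Th := Th) (U := U) (δ := δ) φ ρ β) := by
  rintro p q ⟨r, hr⟩ ⟨σ, hσ, d⟩
  refine ⟨_, realizes_of_extends hr hσ, ?_⟩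
  rw [← Formula.subst_subst]
  exact derives_of_extends hr d

theorem eqHolds_mono {A : Sg.Srt} (a b : WitnessName T A) :
    Monotone (EqHolds (Th := Th) (U := U) (δ := δ) a b) := by
  rintro p q ⟨r, hr⟩ ⟨s, t, hs, ht, d⟩
  exact ⟨_, _, hr.val _ _ hs, hr.val _ _ ht, derives_of_extends hr d⟩

theorem evalHolds_mono {A : Sg.Srt} (t : Term T l A) (a : WitnessName T A) :
    Monotone (EvalHolds (Th := Th) (U := U) (δ := δ) t ρ β a) := by
  rintro p q ⟨r, hr⟩ ⟨σ, s, hσ, hs, d⟩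
  refine ⟨_, _, realizes_of_extends hr hσ, hr.val _ _ hs, ?_⟩
  rw [← Term.subst_subst]
  exact derives_of_extends hr d

theorem appHolds_mono (f : Sg.Fn) (as : ∀ i, WitnessName T (Sg.fnDom f i))
    (a : WitnessName T (Sg.fnCod f)) :
    Monotone (AppHolds (Th := Th) (U := U) (δ := δ) f as a) := by
  rintro p q ⟨r, hr⟩ ⟨ts, s, hts, hs, d⟩
  exact ⟨_, _, fun i => hr.val _ _ (hts i), hr.val _ _ hs, derives_of_extends hr d⟩

theorem relHolds_mono (R : Sg.Rel) (as : ∀ i, WitnessName T (Sg.relDom R i)) :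
    Monotone (RelHolds (Th := Th) (U := U) (δ := δ) R as) := by
  rintro p q ⟨r, hr⟩ ⟨ts, hts, d⟩
  exact ⟨_, fun i => hr.val _ _ (hts i), derives_of_extends hr d⟩

theorem realizable_mono (ρ : ∀ x ∈ V, WitnessName T (T x))
    (β : ∀ B, BVar l B → WitnessName T B) :
    Monotone fun p : Stage Th U δ => ∃ σ, Realizes p.val ρ β σ := by
  rintro p q ⟨r, hr⟩ ⟨σ, hσ⟩
  exact ⟨_, realizes_of_extends hr hσ⟩

theorem forced_realizable
    (hρ : ∀ x hx, Forced (Defined (Th := Th) (U := U) (δ := δ) (ρ x hx)))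
    (hβ : ∀ B b, Forced (Defined (Th := Th) (U := U) (δ := δ) (β B b))) :
    Forced fun p : Stage Th U δ => ∃ σ, Realizes p.val ρ β σ := by
  classical
  have := BVar.finite l
  have h₁ := Forced.forall (ι := {x // x ∈ V}) (fun x => hρ x.1 x.2) fun _ => defined_mono _
  have h₂ := Forced.forall (ι := Σ A, BVar l A) (fun b => hβ b.1 b.2) fun _ => defined_mono _
  refine (h₁.and (fun p q hpq h x => defined_mono _ hpq (h x)) h₂).imp fun p ⟨k₁, k₂⟩ => ?_
  choose τ₁ hτ₁ using k₁
  choose τ₂ hτ₂ using k₂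
  exact ⟨⟨fun x => if hx : x ∈ V then τ₁ ⟨x, hx⟩ else .var x, fun B b => τ₂ ⟨B, b⟩⟩,
    fun x hx => by simpa only [dif_pos hx] using hτ₁ ⟨x, hx⟩, fun B b => hτ₂ ⟨B, b⟩⟩

theorem derives_of_holds {φ : Formula T l} (hφ : φ.InCtx V) {p : Stage Th U δ}
    {σ : Substitution T l p.l} (hσ : Realizes p.val ρ β σ) (h : Holds φ ρ β p) :
    Derives Th U p.l p.θ (φ.subst σ) := by
  obtain ⟨τ, hτ, d⟩ := h
  rwa [Formula.subst_congr hφ (agree_of_realizes hσ hτ)]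

theorem derives_of_evalHolds {A : Sg.Srt} {t : Term T l A} (ht : t.InCtx V) {p : Stage Th U δ}
    {σ : Substitution T l p.l} (hσ : Realizes p.val ρ β σ) {a : WitnessName T A}
    {s : Term T p.l A} (hs : p.val ⟨A, a⟩ = some s) (h : EvalHolds t ρ β a p) :
    Derives Th U p.l p.θ (.eq s (t.subst σ)) := by
  obtain ⟨τ, s', hτ, hs', d⟩ := h
  obtain rfl := Option.some.inj (hs.symm.trans hs')
  rwa [Term.subst_congr (agree_of_realizes hσ hτ) ht]

/-- A forced existential formula has a named witness. -/
theorem forced_wit {A : Sg.Srt} {φ : Formula T (A :: l)}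
    (h : Forced (Holds (Th := Th) (U := U) (δ := δ) (.ex A φ) ρ β)) :
    Forced (Holds (Th := Th) (U := U) (δ := δ) φ ρ (BVar.cons (.wit φ ρ β) β)) := by
  have real : ∀ {q : Stage Th U δ} {σ : Substitution T l q.l} {t : Term T q.l A},
      Realizes q.val ρ β σ → q.val ⟨A, .wit φ ρ β⟩ = some t →
      Realizes q.val ρ (BVar.cons (.wit φ ρ β) β) (.cons t σ) := by
    refine fun hσ ht => ⟨hσ.1, fun B b => ?_⟩
    cases b with
    | zero => exact ht
    | succ b => exact hσ.2 B b
  intro p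
  obtain ⟨q, hpq, σ, hσ, d⟩ := h p
  -- If the name already has a value, `val_wit` makes it a witness. Otherwise a fresh variable is
  -- adjoined as its value.
  cases hv : q.val ⟨A, .wit φ ρ β⟩ with
  | some t =>
    obtain ⟨σ', hσ', d'⟩ := q.val_wit _ _ _ _ _ _ _ hv
    exact ⟨q, hpq, _, real hσ' hv, d'⟩
  | none =>
    have hext := extends_extendWit q hσ d hv
    refine ⟨_, hpq.trans ⟨_, hext⟩, _,
      real (realizes_of_extends hext hσ) (val_extendWit q hσ d hv), ?_⟩
    have d' : Derives Th U (A :: q.l) (.and (q.θ.weaken A) (φ.subst (σ.lift A)))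
        (φ.subst (σ.lift A)) := .and_right (Formula.weaken_inCtx.2 q.θ_inCtx) d.inCtx.2
    exact (Substitution.lift_eq_cons σ A) ▸ d'

theorem holds_ex_of_holds {A : Sg.Srt} {φ : Formula T (A :: l)} (hφ : φ.InCtx V)
    {a : WitnessName T A} {p : Stage Th U δ} (h : Holds φ ρ (BVar.cons a β) p) :
    Holds (.ex A φ) ρ β p := by
  obtain ⟨τ, hτ, d⟩ := h
  let σ : Substitution T l p.l := ⟨τ.var, fun B b => τ.bvar B (.succ b)⟩
  have hσ : Realizes p.val ρ β σ := ⟨hτ.1, fun B b => hτ.2 B (.succ b)⟩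
  refine ⟨σ, hσ, ?_⟩
  have ht : (τ.bvar A .zero).InCtx U := p.val_inCtx _ _ (hτ.2 A .zero)
  have d' := Derives.ex_intro (Th := Th) (hφ.subst ((maps_of_realizes hσ).lift A)) ht
  rw [Formula.subst_subst, Substitution.lift_comp_inst] at d'
  refine Derives.cut ?_ d'
  convert d using 2
  refine Substitution.ext_of (fun _ => rfl) fun B b => ?_
  cases b <;> rfl

variable (Th U δ) in
/-- The names that denote elements of the canonical model. -/
abbrev Name (A : Sg.Srt) : Type u :=
  {a : WitnessName T A // Forced (Defined (Th := Th) (U := U) (δ := δ) a)}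

variable (Th U δ) in
/-- Names are identified if they are forced to be equal. -/
def nameSetoid (A : Sg.Srt) : Setoid (Name Th U δ A) where
  r a b := Forced (EqHolds (Th := Th) (U := U) (δ := δ) a.1 b.1)
  iseqv :=
    { refl := fun a => a.2.imp fun p ⟨t, ht⟩ =>
        ⟨t, t, ht, ht, .eq_rfl p.θ_inCtx (p.val_inCtx _ _ ht)⟩
      symm := fun h => h.imp fun p ⟨s, t, hs, ht, d⟩ => ⟨t, s, ht, hs, d.eq_symm⟩
      trans := fun h₁ h₂ => (h₁.and (eqHolds_mono _ _) h₂).imp fun p h => by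
        obtain ⟨⟨s, t, hs, ht, d⟩, ⟨t', r, ht', hr, d'⟩⟩ := h
        obtain rfl := Option.some.inj (ht.symm.trans ht')
        exact ⟨s, r, hs, hr, d.eq_trans d'⟩ }

/-- There are no names built from function symbols. The value of `f` is named as the witness of the
provable formula `∃ z, z = f(…)`, with the arguments as parameters. -/
theorem exists_forced_appHolds (f : Sg.Fn) (as : ∀ i, Name Th U δ (Sg.fnDom f i)) :
    ∃ a : Name Th U δ (Sg.fnCod f),
      Forced (AppHolds (Th := Th) (U := U) (δ := δ) f (fun i => (as i).1) a.1) := by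
  obtain ⟨l, b, h⟩ := BVar.exists_tuple (Sg.fnDom f)
  obtain ⟨β, hβ⟩ := h (Name Th U δ) as
  let φ : Formula T (Sg.fnCod f :: l) :=
    .eq (.bvar .zero) (.app f fun i => .bvar (.succ (b i)))
  -- All parameters are passed through nameless variables, so the named context is empty.
  let ρ : ∀ x ∈ (∅ : Finset X), WitnessName T (T x) := fun x hx => absurd hx (Finset.notMem_empty x)
  have hφ : φ.InCtx (∅ : Finset X) := ⟨trivial, fun _ => trivial⟩
  have hex : Forced (Holds (Th := Th) (U := U) (δ := δ) (.ex _ φ) ρ fun B b => (β B b).1) := by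
    refine (forced_realizable (ρ := ρ) (fun x hx => absurd hx (Finset.notMem_empty x))
      fun B b => (β B b).2).imp fun p hp => ?_
    obtain ⟨σ, hσ⟩ := hp
    refine ⟨σ, hσ, ?_⟩
    have hm := maps_of_realizes hσ
    let t : Term T p.l (Sg.fnCod f) := .app f fun i => σ.bvar _ (b i)
    have ht : t.InCtx U := fun i => hm.2 _ _
    have d := Derives.ex_intro (Th := Th) (hφ.subst (hm.lift _)) ht
    rw [Formula.subst_subst, Substitution.lift_comp_inst] at d
    exact (Derives.eq_rfl p.θ_inCtx ht).cut d
  have hw := forced_wit hex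
  refine ⟨⟨.wit φ ρ fun B b => (β B b).1, hw.imp fun p ⟨σ, hσ, _⟩ => ⟨_, hσ.2 _ .zero⟩⟩,
    hw.imp fun p ⟨σ, hσ, d⟩ => ⟨fun i => σ.bvar _ (.succ (b i)), σ.bvar _ .zero, fun i => ?_,
      hσ.2 _ .zero, d⟩⟩
  have h' : p.val ⟨_, (β _ (b i)).1⟩ = some (σ.bvar _ (.succ (b i))) := hσ.2 _ (.succ (b i))
  rwa [hβ i] at h'

variable (Th U δ) in
/-- The canonical model of `δ`. -/
noncomputable def model : SetStructure Sg where
  carrier A := Quotient (nameSetoid Th U δ A)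
  fn f as := Quotient.mk _ (exists_forced_appHolds f fun i => (as i).out).choose
  rel R as := Forced (RelHolds (Th := Th) (U := U) (δ := δ) R fun i => (as i).out.1)

/-- The element of the canonical model with the given name. -/
def elem {A : Sg.Srt} (a : Name Th U δ A) : (model Th U δ).carrier A :=
  Quotient.mk (nameSetoid Th U δ A) a

theorem elem_eq_iff {A : Sg.Srt} (a b : Name Th U δ A) :
    elem a = elem b ↔ Forced (EqHolds (Th := Th) (U := U) (δ := δ) a.1 b.1) :=
  Quotient.eq (r := nameSetoid Th U δ A)

theorem exists_name {A : Sg.Srt} (m : (model Th U δ).carrier A) :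
    ∃ a : Name Th U δ A, elem a = m :=
  Quotient.exists_rep m

theorem forced_out {A : Sg.Srt} (a : Name Th U δ A) :
    Forced (EqHolds (Th := Th) (U := U) (δ := δ) a.1 (Quotient.out (elem a)).1) :=
  (elem_eq_iff a _).1 (Quotient.out_eq (s := nameSetoid Th U δ A) (elem a)).symm

theorem forall_eqHolds {n : ℕ} {s : Fin n → Sg.Srt} {as bs : ∀ i, WitnessName T (s i)}
    {p : Stage Th U δ} (h : ∀ i, EqHolds (as i) (bs i) p) {ts : ∀ i, Term T p.l (s i)}
    (ha : ∀ i, p.val ⟨_, as i⟩ = some (ts i)) :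
    ∃ rs : ∀ i, Term T p.l (s i), (∀ i, p.val ⟨_, bs i⟩ = some (rs i)) ∧
      ∀ i, Derives Th U p.l p.θ (.eq (ts i) (rs i)) := by
  choose us rs hu hr d using h
  refine ⟨rs, hr, fun i => ?_⟩
  rw [← Option.some.inj ((hu i).symm.trans (ha i))]
  exact d i

/-- Independence of the representatives and of the chosen name: on a dense set of stages all names
involved have values that are provably equal. -/
theorem fn_elem {f : Sg.Fn} {as : ∀ i, Name Th U δ (Sg.fnDom f i)} {a : Name Th U δ (Sg.fnCod f)}
    (h : Forced (AppHolds (Th := Th) (U := U) (δ := δ) f (fun i => (as i).1) a.1)) :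
    (model Th U δ).fn f (fun i => elem (as i)) = elem a := by
  have h' := (exists_forced_appHolds f fun i => (elem (as i)).out).choose_spec
  refine (elem_eq_iff _ _).2 ?_
  have h₂ := Forced.forall (fun i => forced_out (as i)) fun _ => eqHolds_mono _ _
  refine ((h.and (appHolds_mono _ _ _) h').and ?_ h₂).imp ?_
  · exact fun p q hpq k => ⟨appHolds_mono _ _ _ hpq k.1, appHolds_mono _ _ _ hpq k.2⟩
  · rintro p ⟨⟨⟨ts, s, hts, hs, d⟩, ⟨ts', s', hts', hs', d'⟩⟩, k⟩
    obtain ⟨rs, hrs, e⟩ := forall_eqHolds k hts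
    obtain rfl : rs = ts' := funext fun i => Option.some.inj ((hrs i).symm.trans (hts' i))
    exact ⟨s', s, hs', hs, d'.eq_trans ((Derives.app_congr p.θ_inCtx e).eq_symm.eq_trans d.eq_symm)⟩

theorem rel_elem {R : Sg.Rel} {as : ∀ i, Name Th U δ (Sg.relDom R i)} :
    (model Th U δ).rel R (fun i => elem (as i)) ↔
      Forced (RelHolds (Th := Th) (U := U) (δ := δ) R fun i => (as i).1) := by
  have h₂ := Forced.forall (fun i => forced_out (as i)) fun _ => eqHolds_mono _ _
  constructor
  · intro h
    refine (Forced.and h (relHolds_mono _ _) h₂).imp ?_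
    rintro p ⟨⟨ts, hts, d⟩, k⟩
    have k' : ∀ i, EqHolds (elem (as i)).out.1 (as i).1 p := fun i => by
      obtain ⟨s, t, hs, ht, d⟩ := k i
      exact ⟨t, s, ht, hs, d.eq_symm⟩
    obtain ⟨rs, hrs, e⟩ := forall_eqHolds k' hts
    exact ⟨rs, hrs, .rel_congr e d⟩
  · intro h
    refine (Forced.and h (relHolds_mono _ _) h₂).imp ?_
    rintro p ⟨⟨ts, hts, d⟩, k⟩
    obtain ⟨rs, hrs, e⟩ := forall_eqHolds k hts
    exact ⟨rs, hrs, .rel_congr e d⟩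

theorem exists_eval (ρ : ∀ x ∈ V, Name Th U δ (T x)) (β : ∀ B, BVar l B → Name Th U δ B)
    {A : Sg.Srt} (t : Term T l A) (ht : t.InCtx V) :
    ∃ a : Name Th U δ A,
      (model Th U δ).eval (fun x hx => elem (ρ x hx)) (fun B b => elem (β B b)) t ht = elem a ∧
      Forced (EvalHolds (Th := Th) (U := U) (δ := δ) t (fun x hx => (ρ x hx).1)
        (fun B b => (β B b).1) a.1) := by
  have hr := forced_realizable (fun x hx => (ρ x hx).2) fun B b => (β B b).2
  induction t with
  | var x =>
    refine ⟨ρ x ht, rfl, hr.imp fun p ⟨σ, hσ⟩ => ⟨σ, _, hσ, hσ.1 x ht, ?_⟩⟩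
    exact .eq_rfl p.θ_inCtx ((maps_of_realizes hσ).1 x ht)
  | bvar b =>
    refine ⟨β _ b, rfl, hr.imp fun p ⟨σ, hσ⟩ => ⟨σ, _, hσ, hσ.2 _ b, ?_⟩⟩
    exact .eq_rfl p.θ_inCtx ((maps_of_realizes hσ).2 _ b)
  | app f ts ih =>
    choose as has hev using fun i => ih i (ht i)
    obtain ⟨a, ha⟩ := exists_forced_appHolds f as
    refine ⟨a, ?_, ?_⟩
    · simp only [SetStructure.eval, has]
      exact fn_elem ha
    · have h₂ := Forced.forall hev fun _ => evalHolds_mono _ _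
      refine ((hr.and (realizable_mono _ _) ha).and ?_ h₂).imp ?_
      · exact fun p q hpq k => ⟨realizable_mono _ _ hpq k.1, appHolds_mono _ _ _ hpq k.2⟩
      · rintro p ⟨⟨⟨σ, hσ⟩, ⟨rs, s, hrs, hs, d⟩⟩, k⟩
        refine ⟨σ, s, hσ, hs, d.eq_trans (Derives.app_congr p.θ_inCtx fun i => ?_)⟩
        exact derives_of_evalHolds (ht i) hσ (hrs i) (k i)

/-- The truth lemma. The quantifier case rests on `forced_wit`: a single name witnesses the
existential on a dense set of stages, so it denotes an element. -/
theorem sat_iff (φ : Formula T l) (hφ : φ.InCtx V) (ρ : ∀ x ∈ V, Name Th U δ (T x))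
    (β : ∀ B, BVar l B → Name Th U δ B) :
    (model Th U δ).Sat (fun x hx => elem (ρ x hx)) φ hφ (fun B b => elem (β B b)) ↔
      Forced (Holds (Th := Th) (U := U) (δ := δ) φ (fun x hx => (ρ x hx).1)
        fun B b => (β B b).1) := by
  induction φ with
  | top =>
    have hr := forced_realizable (fun x hx => (ρ x hx).2) fun B b => (β B b).2
    exact iff_of_true trivial (hr.imp fun p ⟨σ, hσ⟩ => ⟨σ, hσ, .top p.θ_inCtx⟩)
  | and φ ψ ih₁ ih₂ =>
    refine (and_congr (ih₁ hφ.1 β) (ih₂ hφ.2 β)).trans ⟨fun h => ?_, fun h => ⟨?_, ?_⟩⟩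
    · refine (h.1.and (holds_mono _) h.2).imp fun p ⟨⟨σ, hσ, d⟩, k⟩ => ⟨σ, hσ, ?_⟩
      exact .and_intro d (derives_of_holds hφ.2 hσ k)
    · exact h.imp fun p ⟨σ, hσ, d⟩ => ⟨σ, hσ, d.cut (.and_left d.inCtx.2.1 d.inCtx.2.2)⟩
    · exact h.imp fun p ⟨σ, hσ, d⟩ => ⟨σ, hσ, d.cut (.and_right d.inCtx.2.1 d.inCtx.2.2)⟩
  | eq s t =>
    obtain ⟨a, ha, ha'⟩ := exists_eval ρ β s hφ.1
    obtain ⟨b, hb, hb'⟩ := exists_eval ρ β t hφ.2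
    simp only [SetStructure.Sat, ha, hb, elem_eq_iff]
    have hab := ha'.and (evalHolds_mono _ _) hb'
    have hm : Monotone fun p : Stage Th U δ => EvalHolds s (fun x hx => (ρ x hx).1)
        (fun B b => (β B b).1) a.1 p ∧ EvalHolds t (fun x hx => (ρ x hx).1)
        (fun B b => (β B b).1) b.1 p :=
      fun p q hpq k => ⟨evalHolds_mono _ _ hpq k.1, evalHolds_mono _ _ hpq k.2⟩
    constructor
    · refine fun h => (hab.and hm h).imp ?_
      rintro p ⟨⟨⟨σ, s', hσ, hs', d⟩, k⟩, ⟨s'', t', hs'', ht', e⟩⟩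
      obtain rfl := Option.some.inj (hs'.symm.trans hs'')
      exact ⟨σ, hσ, d.eq_symm.eq_trans (e.eq_trans (derives_of_evalHolds hφ.2 hσ ht' k))⟩
    · refine fun h => (hab.and hm h).imp ?_
      rintro p ⟨⟨⟨σ, s', hσ, hs', d⟩, k⟩, k'⟩
      obtain ⟨t', ht'⟩ : ∃ t', p.val ⟨_, b.1⟩ = some t' := by
        obtain ⟨_, t', _, ht', _⟩ := k
        exact ⟨t', ht'⟩
      refine ⟨s', t', hs', ht', d.eq_trans ?_⟩
      exact (derives_of_holds hφ hσ k').eq_trans (derives_of_evalHolds hφ.2 hσ ht' k).eq_symm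
  | rel R ts =>
    choose as has hev using fun i => exists_eval ρ β (ts i) (hφ i)
    simp only [SetStructure.Sat, has]
    rw [rel_elem]
    have hr := forced_realizable (fun x hx => (ρ x hx).2) fun B b => (β B b).2
    have h₂ := hr.and (realizable_mono _ _) (Forced.forall hev fun _ => evalHolds_mono _ _)
    constructor
    · refine fun h => (h.and (relHolds_mono _ _) h₂).imp ?_
      rintro p ⟨⟨rs, hrs, d⟩, ⟨σ, hσ⟩, k⟩
      exact ⟨σ, hσ, .rel_congr (fun i => derives_of_evalHolds (hφ i) hσ (hrs i) (k i)) d⟩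
    · refine fun h => (h.and (holds_mono _) h₂).imp ?_
      rintro p ⟨k', ⟨σ, hσ⟩, k⟩
      have hd : ∀ i, ∃ t, p.val ⟨_, (as i).1⟩ = some t := fun i => by
        obtain ⟨_, t', _, ht', _⟩ := k i
        exact ⟨t', ht'⟩
      choose rs hrs using hd
      refine ⟨rs, hrs, .rel_congr (fun i => ?_) (derives_of_holds hφ hσ k')⟩
      exact (derives_of_evalHolds (hφ i) hσ (hrs i) (k i)).eq_symm
  | ex A φ ih =>
    have hcons : ∀ a : Name Th U δ A,
        (model Th U δ).Sat (fun x hx => elem (ρ x hx)) φ hφ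
          (BVar.cons (F := (model Th U δ).carrier) (elem a) fun B b => elem (β B b)) ↔
        Forced (Holds (Th := Th) (U := U) (δ := δ) φ (fun x hx => (ρ x hx).1)
          (BVar.cons a.1 fun B b => (β B b).1)) := by
      intro a
      convert ih hφ (BVar.cons a β) using 2
      · funext B b
        cases b <;> rfl
      · congr 1
        funext B b
        cases b <;> rfl
    constructor
    · rintro ⟨m, hm⟩
      obtain ⟨a, rfl⟩ := exists_name m
      exact ((hcons a).1 hm).imp fun p hp => holds_ex_of_holds hφ hp
    · intro h
      have hw := forced_wit h
      exact ⟨_, (hcons ⟨_, hw.imp fun p ⟨σ, hσ, _⟩ => ⟨_, hσ.2 _ .zero⟩⟩).2 hw⟩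

theorem model_isModel : (model Th U δ).IsModel Th := by
  intro s hs ρ β
  choose ρ' hρ' using fun x hx => exists_name (ρ x hx)
  choose β' hβ' using fun B b => exists_name (β B b)
  obtain rfl : (fun x hx => elem (ρ' x hx)) = ρ := funext fun x => funext (hρ' x)
  obtain rfl : (fun B b => elem (β' B b)) = β := funext fun B => funext (hβ' B)
  rw [sat_iff, sat_iff]
  exact fun h => h.imp fun p ⟨σ, hσ, d⟩ =>
    ⟨σ, hσ, d.cut (.subst σ (maps_of_realizes hσ) (.ax s hs))⟩

end Stage

/-- Completeness of regular logic for models in the category of sets. -/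
theorem exists_setStructure_of_not_derives {Th : Set (Sequent T)} {U : Finset X}
    {δ φ : Formula T []} (hδ : δ.InCtx U) (hφ : φ.InCtx U) (h : ¬ Derives Th U [] δ φ) :
    ∃ M : SetStructure Sg, M.IsModel Th ∧ ∃ ρ : ∀ x ∈ U, M.carrier (T x),
      M.Sat ρ δ hδ BVar.elim0 ∧ ¬ M.Sat ρ φ hφ BVar.elim0 := by
  let ρ : ∀ x ∈ U, Stage.Name Th U δ (T x) := fun x hx =>
    ⟨.base x, fun p => ⟨p, le_rfl, _, p.val_base x hx⟩⟩
  let β : ∀ B, BVar [] B → Stage.Name Th U δ B := fun B b => nomatch b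
  have hβ : (fun B b => Stage.elem (β B b)) = BVar.elim0 := by
    funext B b
    exact nomatch b
  refine ⟨_, Stage.model_isModel, fun x hx => Stage.elem (ρ x hx), ?_, ?_⟩
  · rw [← hβ, Stage.sat_iff]
    exact fun p => ⟨p, le_rfl, .ofNil T p.l, ⟨fun x hx => p.val_base x hx, fun B b => nomatch b⟩,
      p.derives⟩
  · rw [← hβ, Stage.sat_iff]
    intro hf
    -- Density is applied to any one stage, and the initial one shows that a stage exists.
    -- Conservativity of `q` then brings the derivation back to `δ`.
    obtain ⟨q, _, σ, hσ, d⟩ := hf (Stage.initial hδ)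
    refine h (q.conservative φ hφ ?_)
    rwa [Formula.subst_congr (σ := .ofNil T q.l) (τ := σ) hφ]
    exact ⟨fun x hx => Option.some.inj ((q.val_base x hx).symm.trans (hσ.1 x hx)),
      fun B b => nomatch b⟩

end Completeness

/-! ### A small regular category of sets; pairing provides fibre products. -/

/-- The closure of a type under pairing, with a distinguished element. -/
inductive PairClosure (α : Type u) : Type u
  | of (a : α) : PairClosure α
  | unit : PairClosure α
  | pair (a b : PairClosure α) : PairClosure α

/-- The subsets of `PairClosure α`, as the objects of a small category of sets. The universe `v'`
does not matter for the objects; it determines that of the arrows. -/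
def SmallSet.{v', w', u'} (α : Type u') : Type (max u' w') :=
  Function.const PUnit.{v' + 1} (ULift.{w', u'} (Set (PairClosure α))) PUnit.unit

namespace SmallSet

variable {α : Type u}

/-- The subset, as an object. -/
def mk' (s : Set (PairClosure α)) : SmallSet.{v, w} α := ULift.up s

/-- The object, as a subset. -/
def set (s : SmallSet.{v, w} α) : Set (PairClosure α) := ULift.down s

/-- The elements of an object. -/
def El (s : SmallSet.{v, w} α) : Type u := {a // a ∈ s.set}

instance : Category.{max u v} (SmallSet.{v, w} α) where
  Hom s t := ULift.{v} (s.El → t.El)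
  id s := ⟨fun a => a⟩
  comp f g := ⟨fun a => g.down (f.down a)⟩

variable {P Q R : SmallSet.{v, w} α}

/-- The arrow given by a function. -/
def hom (f : P.El → Q.El) : P ⟶ Q := ULift.up f

/-- The function given by an arrow. -/
def ap (f : P ⟶ Q) : P.El → Q.El := ULift.down f

theorem hom_ext {f g : P ⟶ Q} (h : ∀ a, ap f a = ap g a) : f = g :=
  ULift.ext _ _ (funext h)

/-- The one-element set. -/
def pt : SmallSet.{v, w} α := mk' {.unit}

/-- The element of the one-element set. -/
def ptEl : (pt : SmallSet.{v, w} α).El := ⟨.unit, rfl⟩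

theorem pt_ext (a : (pt : SmallSet.{v, w} α).El) : a = ptEl := Subtype.ext a.2

/-- An element, as an arrow. -/
def point (a : P.El) : (pt : SmallSet.{v, w} α) ⟶ P := hom fun _ => a

theorem point_comp (a : P.El) (f : P ⟶ Q) : point a ≫ f = point (ap f a) := rfl

theorem point_injective {a b : P.El}
    (h : (point a : (pt : SmallSet.{v, w} α) ⟶ P) = point b) : a = b :=
  congrArg (fun f => ap f ptEl) h

/-- Elements are arrows from `pt`, so cancellation can be tested on them. -/
theorem injective_of_mono (f : P ⟶ Q) [Mono f] : Function.Injective (ap f) := fun a b h =>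
  point_injective ((cancel_mono f).1 (by rw [point_comp, point_comp, h]))

theorem mono_of_injective (f : P ⟶ Q) (h : Function.Injective (ap f)) : Mono f :=
  ⟨fun _ _ e => hom_ext fun a => h (congrArg (fun f => ap f a) e)⟩

/-- A function that is constant on the fibres of a surjective one descends along it. -/
theorem exists_desc (e : P ⟶ Q) (he : Function.Surjective (ap e)) (k : P ⟶ R)
    (hk : ∀ a b, ap e a = ap e b → ap k a = ap k b) : ∃ u : Q ⟶ R, e ≫ u = k :=
  ⟨hom fun b => ap k (Function.surjInv he b),
    hom_ext fun a => hk _ _ (Function.surjInv_eq he (ap e a))⟩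

theorem epi_of_surjective (f : P ⟶ Q) (h : Function.Surjective (ap f)) : Epi f :=
  ⟨fun g k e => hom_ext fun b => by
    obtain ⟨a, rfl⟩ := h b
    exact congrArg (fun f => ap f a) e⟩

instance : HasTerminal (SmallSet.{v, w} α) :=
  (IsTerminal.ofUniqueHom (fun _ => hom fun _ => ptEl)
    (fun _ _ => hom_ext fun _ => pt_ext _) : IsTerminal (pt : SmallSet.{v, w} α)).hasTerminal

/-- The fibre product of two functions. -/
def fibreProduct (f : P ⟶ R) (g : Q ⟶ R) : SmallSet.{v, w} α :=
  mk' {c | ∃ (a : P.El) (b : Q.El), c = .pair a.1 b.1 ∧ ap f a = ap g b}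

theorem exists_isPullback (f : P ⟶ R) (g : Q ⟶ R) :
    ∃ (p : fibreProduct f g ⟶ P) (q : fibreProduct f g ⟶ Q), IsPullback p q f g := by
  -- The projections are chosen, but injectivity of `pair` determines them.
  choose p q hpq h using fun c : (fibreProduct f g).El => c.2
  refine ⟨hom p, hom q, ⟨⟨hom_ext h⟩, ⟨PullbackCone.IsLimit.mk _
    (fun s => hom fun x => ⟨.pair (ap s.fst x).1 (ap s.snd x).1, _, _, rfl,
      congrArg (fun f => ap f x) s.condition⟩) (fun s => hom_ext fun x => ?_)
    (fun s => hom_ext fun x => ?_) fun s m h₁ h₂ => hom_ext fun x => Subtype.ext ?_⟩⟩⟩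
  · exact Subtype.ext (PairClosure.pair.inj (hpq ⟨.pair (ap s.fst x).1 (ap s.snd x).1, _⟩)).1.symm
  · exact Subtype.ext (PairClosure.pair.inj (hpq ⟨.pair (ap s.fst x).1 (ap s.snd x).1, _⟩)).2.symm
  · refine (hpq _).trans ?_
    exact congrArg₂ PairClosure.pair (congrArg (fun f => (ap f x).1) h₁)
      (congrArg (fun f => (ap f x).1) h₂)

instance : HasPullbacks (SmallSet.{v, w} α) :=
  have : ∀ {P Q R : SmallSet.{v, w} α} {f : P ⟶ R} {g : Q ⟶ R}, HasLimit (cospan f g) := by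
    intro P Q R f g
    obtain ⟨p, q, h⟩ := exists_isPullback f g
    exact h.hasPullback
  hasPullbacks_of_hasLimit_cospan _

instance : HasFiniteLimits (SmallSet.{v, w} α) := hasFiniteLimits_of_hasTerminal_and_pullbacks

theorem exists_of_isPullback {P' : SmallSet.{v, w} α} {p : P' ⟶ P} {q : P' ⟶ Q} {f : P ⟶ R}
    {g : Q ⟶ R} (h : IsPullback p q f g) {a : P.El} {b : Q.El} (hab : ap f a = ap g b) :
    ∃ c, ap p c = a ∧ ap q c = b := by
  have w : (point a : (pt : SmallSet.{v, w} α) ⟶ P) ≫ f = point b ≫ g := by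
    rw [point_comp, point_comp, hab]
  exact ⟨ap (h.lift _ _ w) ptEl, congrArg (fun f => ap f ptEl) (h.lift_fst _ _ w),
    congrArg (fun f => ap f ptEl) (h.lift_snd _ _ w)⟩

/-- An arrow that coequalises the kernel pair is constant on fibres and so descends along `f`. -/
theorem isRegularEpi_of_surjective (f : P ⟶ Q) (h : Function.Surjective (ap f)) :
    IsRegularEpi f := by
  have := epi_of_surjective f h
  refine IsRegularEpi.of_epi_of_exists fun Z k hk => exists_desc f h k fun a b hab => ?_
  obtain ⟨c, rfl, rfl⟩ := exists_of_isPullback (IsPullback.of_hasPullback f f) hab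
  exact congrArg (fun f => ap f c) hk

/-- The image of a function. -/
def image (f : P ⟶ Q) : SmallSet.{v, w} α := mk' {b | ∃ a : P.El, (ap f a).1 = b}

/-- The inclusion of the image. -/
def imageIncl (f : P ⟶ Q) : image f ⟶ Q :=
  hom fun b => ⟨b.1, by obtain ⟨a, h⟩ := b.2; exact h ▸ (ap f a).2⟩

/-- The function, as a function onto its image. -/
def toImage (f : P ⟶ Q) : P ⟶ image f := hom fun a => ⟨_, a, rfl⟩

theorem surjective_toImage (f : P ⟶ Q) : Function.Surjective (ap (toImage f)) := by
  rintro ⟨_, a, rfl⟩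
  exact ⟨a, rfl⟩

theorem ap_toImage_eq_iff (f : P ⟶ Q) {a b : P.El} :
    ap (toImage f) a = ap (toImage f) b ↔ ap f a = ap f b :=
  Subtype.ext_iff.trans (Subtype.ext_iff (a1 := ap f a) (a2 := ap f b)).symm

/-- A strong epi lifts against the inclusion of its image, which gives every element of `Q` a
preimage. -/
theorem surjective_of_isRegularEpi (f : P ⟶ Q) [IsRegularEpi f] :
    Function.Surjective (ap f) := by
  have : Mono (imageIncl f) := mono_of_injective _ fun a b h =>
    Subtype.ext (congrArg Subtype.val h :)
  have := strongEpi_of_isRegularEpi f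
  have sq : CommSq (toImage f) f (imageIncl f) (𝟙 Q) := ⟨rfl⟩
  intro b
  obtain ⟨a, ha⟩ := surjective_toImage f (ap sq.lift b)
  refine ⟨a, ?_⟩
  have h₁ : ap (imageIncl f) (ap (toImage f) a) = ap f a := rfl
  rw [← h₁, ha]
  exact congrArg (fun f => ap f b) sq.fac_right

/-- The coequaliser of the kernel pair of `f` is the image of `f`; base change preserves regular
epis because they are the surjections. -/
instance : Regular (SmallSet.{v, w} α) where
  hasCoequalizer_of_isKernelPair {P Q R f g₁ g₂} h := by
    have := epi_of_surjective _ (surjective_toImage f)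
    have w : g₁ ≫ toImage f = g₂ ≫ toImage f := hom_ext fun c =>
      (ap_toImage_eq_iff f).2 (congrArg (fun f => ap f c) h.w)
    refine ⟨⟨Cofork.ofπ (toImage f) w, Cofork.IsColimit.mk' _ fun s => ?_⟩⟩
    have hd := exists_desc (toImage f) (surjective_toImage f) s.π fun a b hab => by
      obtain ⟨c, rfl, rfl⟩ := exists_of_isPullback h ((ap_toImage_eq_iff f).1 hab)
      exact congrArg (fun f => ap f c) s.condition
    exact ⟨hd.choose, hd.choose_spec, fun {m} hm =>
      (cancel_epi (toImage f)).1 (hm.trans hd.choose_spec.symm)⟩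
  regularEpiIsStableUnderBaseChange := by
    refine ⟨fun {P Q R P' f g f' g'} h hf => ?_⟩
    have : IsRegularEpi g := hf
    refine isRegularEpi_of_surjective _ fun b => ?_
    obtain ⟨a, ha⟩ := surjective_of_isRegularEpi g (ap f b)
    obtain ⟨c, _, hc⟩ := exists_of_isPullback h ha
    exact ⟨c, hc⟩

theorem factors_iff_forall (B : Subobject Q) (f : P ⟶ Q) :
    B.Factors f ↔ ∀ a, ∃ b, ap B.arrow b = ap f a := by
  constructor
  · intro h a
    exact ⟨ap (B.factorThru f h) a, congrArg (fun f => ap f a) (B.factorThru_arrow f h)⟩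
  · intro h
    choose g hg using h
    exact (Subobject.factors_iff _ _).2 ⟨hom g, hom_ext hg⟩

/-- The element is in the subobject. -/
def Mem (a : P.El) (B : Subobject P) : Prop :=
  B.Factors (point a : (pt : SmallSet.{v, w} α) ⟶ P)

theorem mem_iff_exists {a : P.El} {B : Subobject P} : Mem a B ↔ ∃ b, ap B.arrow b = a :=
  (factors_iff_forall B _).trans ⟨fun h => h ptEl, fun h _ => h⟩

theorem factors_iff_mem {B : Subobject Q} {f : P ⟶ Q} : B.Factors f ↔ ∀ a, Mem (ap f a) B := by
  simp only [factors_iff_forall, mem_iff_exists]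

theorem le_iff_mem {A B : Subobject P} : A ≤ B ↔ ∀ a, Mem a A → Mem a B := by
  refine ⟨fun h a ha => Subobject.factors_of_le _ h ha, fun h => Subobject.le_of_factors ?_⟩
  exact factors_iff_mem.2 fun a => h _ (mem_iff_exists.2 ⟨a, rfl⟩)

theorem mem_top (a : P.El) : Mem a (⊤ : Subobject P) := Subobject.top_factors _

theorem mem_inf {a : P.El} {A B : Subobject P} : Mem a (A ⊓ B) ↔ Mem a A ∧ Mem a B :=
  Subobject.inf_factors _

theorem mem_pullback {a : P.El} {f : P ⟶ Q} {B : Subobject Q} :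
    Mem a ((Subobject.pullback f).obj B) ↔ Mem (ap f a) B :=
  pullback_factors_iff _ _ _

theorem mem_equalizer {a : P.El} {f g : P ⟶ Q} :
    Mem a (equalizerSubobject f g) ↔ ap f a = ap g a :=
  (equalizerSubobject_factors_iff _ _ _).trans
    ⟨fun h => congrArg (fun f => ap f ptEl) h, fun h => by rw [point_comp, point_comp, h]⟩

/-- A cover of `pt` has an element, so the cover in the Kripke–Joyal clause can be dropped. -/
theorem mem_exists {b : Q.El} {f : P ⟶ Q} {B : Subobject P} :
    Mem b ((Subobject.exists f).obj B) ↔ ∃ a, Mem a B ∧ ap f a = b := by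
  refine (exists_factors_iff _ _ _).trans ⟨?_, ?_⟩
  · rintro ⟨R, e, h, he, hh, w⟩
    obtain ⟨r, -⟩ := surjective_of_isRegularEpi e ptEl
    exact ⟨ap h r, factors_iff_mem.1 hh r, congrArg (fun f => ap f r) w⟩
  · rintro ⟨a, ha, rfl⟩
    exact ⟨pt, 𝟙 _, point a, inferInstance, ha, rfl⟩

/-- The subset of the elements with the property `p`. -/
def sep (P : SmallSet.{v, w} α) (p : P.El → Prop) : SmallSet.{v, w} α :=
  mk' {c | ∃ a : P.El, a.1 = c ∧ p a}

/-- The inclusion of a subset. -/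
def sepIncl (P : SmallSet.{v, w} α) (p : P.El → Prop) : sep P p ⟶ P :=
  hom fun c => ⟨c.1, by obtain ⟨a, h, _⟩ := c.2; exact h ▸ a.2⟩

instance (p : P.El → Prop) : Mono (sepIncl P p) :=
  mono_of_injective _ fun _ _ h => Subtype.ext (congrArg Subtype.val h :)

theorem mem_mk_sepIncl {p : P.El → Prop} {a : P.El} :
    Mem a (Subobject.mk (sepIncl P p)) ↔ p a := by
  refine (Subobject.mk_factors_iff _ _).trans ⟨?_, fun h => ?_⟩
  · rintro ⟨g, hg⟩
    obtain ⟨b, hb, hp⟩ := (ap g ptEl).2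
    have : (ap g ptEl).1 = a.1 := congrArg (fun f => (ap f ptEl).1) hg
    rwa [← Subtype.ext (hb.trans this)]
  · exact ⟨point ⟨a.1, a, rfl, h⟩, rfl⟩

section Products

variable {ι : Type*} [Finite ι] {F : ι → SmallSet.{v, w} α}

/-- The element of the product with the given components. -/
noncomputable def tuple (a : ∀ i, (F i).El) : (∏ᶜ F).El :=
  ap (Pi.lift fun i => (point (a i) : (pt : SmallSet.{v, w} α) ⟶ F i)) ptEl

theorem ap_π_tuple (a : ∀ i, (F i).El) (i : ι) : ap (Pi.π F i) (tuple a) = a i :=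
  congrArg (fun f => ap f ptEl)
    (Pi.lift_π (fun i => (point (a i) : (pt : SmallSet.{v, w} α) ⟶ F i)) i)

theorem pi_ext {a b : (∏ᶜ F).El} (h : ∀ i, ap (Pi.π F i) a = ap (Pi.π F i) b) : a = b :=
  point_injective (Pi.hom_ext _ _ fun i => by rw [point_comp, point_comp, h])

theorem exists_prod (a : P.El) (b : Q.El) :
    ∃ c : (P ⨯ Q).El, ap prod.fst c = a ∧ ap prod.snd c = b :=
  ⟨ap (prod.lift (point a : (pt : SmallSet.{v, w} α) ⟶ P) (point b)) ptEl,
    congrArg (fun f => ap f ptEl) (prod.lift_fst (point a) (point b)),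
    congrArg (fun f => ap f ptEl) (prod.lift_snd (point a) (point b))⟩

end Products

end SmallSet

/-! ### Set structures as interpretations in the small category of sets. -/

namespace SetStructure

open SmallSet

variable {Sg : Signature.{u}} {X : Type u} {T : X → Sg.Srt} (M : SetStructure Sg)

/-- A carrier, as an object of the small category of sets. -/
def code (A : Sg.Srt) : SmallSet.{v, w} (Σ A, M.carrier A) :=
  mk' {c | ∃ m : M.carrier A, c = .of ⟨A, m⟩}

/-- The elements of the code of a carrier are those of the carrier. -/
noncomputable def codeEquiv (A : Sg.Srt) : M.carrier A ≃ (M.code A : SmallSet.{v, w} _).El :=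
  Equiv.ofBijective (fun m => ⟨.of ⟨A, m⟩, m, rfl⟩)
    ⟨fun m n h => by
      have := PairClosure.of.inj (congrArg Subtype.val h)
      exact eq_of_heq (Sigma.mk.inj this).2, by
      rintro ⟨_, m, rfl⟩
      exact ⟨m, rfl⟩⟩

/-- The structure, as an interpretation in the small category of sets. -/
noncomputable def interpretation : Interpretation Sg (SmallSet.{v, w} (Σ A, M.carrier A)) where
  obj := M.code
  fn f := hom fun p => M.codeEquiv _ (M.fn f fun i =>
    (M.codeEquiv _).symm (ap (Pi.π (fun i => M.code (Sg.fnDom f i)) i) p))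
  rel R := Subobject.mk (sepIncl _ fun p => M.rel R fun i =>
    (M.codeEquiv _).symm (ap (Pi.π (fun i => M.code (Sg.relDom R i)) i) p))

variable {P : SmallSet.{v, w} (Σ A, M.carrier A)}

/-- The element of the structure that is the value of an arrow. -/
noncomputable def value {A : Sg.Srt} (f : P ⟶ (interpretation.{v, w} M).obj A) (p : P.El) :
    M.carrier A :=
  (M.codeEquiv A).symm (ap f p)

variable {V : Finset X} {l : List Sg.Srt}

theorem value_term (ρ : ∀ x ∈ V, P ⟶ M.interpretation.obj (T x))
    (β : ∀ B, BVar l B → (P ⟶ M.interpretation.obj B)) {A : Sg.Srt} (t : Term T l A)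
    (h : t.InCtx V) (p : P.El) :
    M.value (M.interpretation.term ρ β t h) p =
      M.eval (fun x hx => M.value (ρ x hx) p) (fun B b => M.value (β B b) p) t h := by
  induction t with
  | var x => rfl
  | bvar b => rfl
  | app f ts ih =>
    refine ((M.codeEquiv _).symm_apply_apply _).trans (congrArg (M.fn f) (funext fun i => ?_))
    refine Eq.trans (congrArg (M.codeEquiv _).symm ?_) (ih i (h i))
    exact congrArg (fun f => ap f p) (Pi.lift_π
      (fun i => M.interpretation.term ρ β (ts i) (h i)) i)

/-- Categorical and Tarskian semantics agree pointwise. Soundness and the counterexample both cross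
over through this. -/
theorem mem_formula (φ : Formula T l) (h : φ.InCtx V) (ρ : ∀ x ∈ V, P ⟶ M.interpretation.obj (T x))
    (β : ∀ B, BVar l B → (P ⟶ M.interpretation.obj B)) (p : P.El) :
    Mem p (M.interpretation.formula φ h ρ β) ↔
      M.Sat (fun x hx => M.value (ρ x hx) p) φ h (fun B b => M.value (β B b) p) := by
  induction φ generalizing P with
  | top => exact iff_of_true (mem_top p) trivial
  | and φ ψ ih₁ ih₂ => exact mem_inf.trans (and_congr (ih₁ h.1 ρ β p) (ih₂ h.2 ρ β p))
  | eq s t =>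
    refine mem_equalizer.trans ?_
    simp only [Sat, ← value_term]
    exact (M.codeEquiv _).symm.injective.eq_iff.symm
  | rel R ts =>
    refine mem_pullback.trans (mem_mk_sepIncl.trans ?_)
    simp only [Sat, ← value_term]
    refine iff_of_eq (congrArg (M.rel R) (funext fun i => congrArg (M.codeEquiv _).symm ?_))
    exact congrArg (fun f => ap f p) (Pi.lift_π
      (fun i => M.interpretation.term ρ β (ts i) (h i)) i)
  | ex A φ ih =>
    have h' : φ.InCtx V := h
    rw [Interpretation.formula_ex _ h', mem_exists]
    have hcons : ∀ q : (P ⨯ M.interpretation.obj A).El,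
        (fun B b => M.value (M.interpretation.extend β A B b) q) =
          BVar.cons (F := M.carrier) (M.value prod.snd q)
            fun B b => M.value (β B b) (ap prod.fst q) := by
      intro q
      funext B b
      cases b <;> rfl
    constructor
    · rintro ⟨q, hq, rfl⟩
      have hs := (ih h' _ _ q).1 hq
      rw [hcons] at hs
      exact ⟨_, hs⟩
    · rintro ⟨m, hm⟩
      obtain ⟨q, rfl, rfl⟩ : ∃ q : (P ⨯ M.interpretation.obj A).El,
          ap prod.fst q = p ∧ M.value prod.snd q = m := by
        obtain ⟨q, h₁, h₂⟩ := exists_prod p (M.codeEquiv A m)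
        exact ⟨q, h₁, (congrArg _ h₂).trans ((M.codeEquiv A).symm_apply_apply m)⟩
      refine ⟨q, (ih h' _ _ q).2 ?_, rfl⟩
      rw [hcons]
      exact hm

theorem interpretation_isModel {Th : Set (Sequent T)} (hM : M.IsModel Th) :
    (interpretation.{v, w} M).IsModel Th := by
  intro s hs
  refine le_iff_mem.2 fun p hp => ?_
  exact (M.mem_formula _ _ _ _ p).2 (hM s hs _ _ ((M.mem_formula _ _ _ _ p).1 hp))

/-- Every assignment of elements is the value of an assignment of arrows. -/
theorem exists_value {A : Sg.Srt} (m : M.carrier A) :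
    ∃ f : (pt : SmallSet.{v, w} _) ⟶ M.interpretation.obj A, M.value f ptEl = m :=
  ⟨point (M.codeEquiv A m), (M.codeEquiv A).symm_apply_apply m⟩

variable {M}

/-- Tarskian soundness is the categorical one read at `pt`, with assignments turned into arrows. -/
theorem IsModel.sat_of_derives {Th : Set (Sequent T)} (hM : M.IsModel Th) {φ ψ : Formula T l}
    (d : Derives Th V l φ ψ) (hφ : φ.InCtx V) (hψ : ψ.InCtx V) {ρ : ∀ x ∈ V, M.carrier (T x)}
    {β : ∀ B, BVar l B → M.carrier B} (h : M.Sat ρ φ hφ β) : M.Sat ρ ψ hψ β := by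
  choose ρ' hρ' using fun x hx => exists_value.{0, 0} M (ρ x hx)
  choose β' hβ' using fun B b => exists_value.{0, 0} M (β B b)
  obtain rfl : (fun x hx => M.value (ρ' x hx) ptEl) = ρ :=
    funext fun x => funext (hρ' x)
  obtain rfl : (fun B b => M.value (β' B b) ptEl) = β := funext fun B => funext (hβ' B)
  rw [← mem_formula] at h ⊢
  exact Subobject.factors_of_le _ ((M.interpretation_isModel hM).sound d hφ hψ ρ' β') h

end SetStructure

/-! ### The subpresheaf of `F` cut out by the local axioms. -/

section NoSignallingModel

variable {Sg : Signature.{u}} {X : Type u} {T : X → Sg.Srt} {C : ContextComplex X}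
  {Th : Set (Sequent T)} {G : Set (Formula T [])} {Δ : C.Face → List (Formula T [])}

/-- In every context, `Δ` is a finite axiomatisation of the formulas in `G`, and the consequences
of `Δ` are in `G`. -/
structure LocallyAxiomatises (Th : Set (Sequent T)) (G : Set (Formula T []))
    (Δ : C.Face → List (Formula T [])) : Prop where
  mem : ∀ U, ∀ ψ ∈ Δ U, ψ ∈ G ∩ Phi T U.1
  derives : ∀ U, ∀ ψ ∈ G ∩ Phi T U.1, Derives Th U.1 [] (Formula.conj (Δ U)) ψ
  closed : ∀ U ψ, Derives Th U.1 [] (Formula.conj (Δ U)) ψ → ψ ∈ G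

namespace LocallyAxiomatises

variable (hΔ : LocallyAxiomatises Th G Δ)

include hΔ in
theorem conj_inCtx (U : C.Face) : (Formula.conj (Δ U)).InCtx U.1 :=
  Formula.conj_inCtx.2 fun ψ hψ => (hΔ.mem U ψ hψ).2

section Presheaf

variable {S : Type w} [Category.{v} S] [Regular S] (M : Interpretation Sg S)

/-- The subobject of `F_U` given by the conjunction of the axioms in context `U`. -/
noncomputable def sub (U : C.Face) : Subobject (M.ctx T U.1) :=
  M.phi U.1 (Formula.conj (Δ U)) (hΔ.conj_inCtx U)

variable {M} (hM : M.IsModel Th)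

include hM in
theorem sub_le {U : C.Face} {ψ : Formula T []} (h : ψ ∈ G ∩ Phi T U.1) :
    hΔ.sub M U ≤ M.phi U.1 ψ h.2 :=
  hM.sound (hΔ.derives U ψ h) (hΔ.conj_inCtx U) h.2 _ _

include hM in
-- An axiom of `Δ U` also lives in `V` and belongs to `G`, so `Δ V` proves it.
theorem sub_factors_restr {U V : C.Face} (hUV : U.1 ⊆ V.1) :
    (hΔ.sub M U).Factors ((hΔ.sub M V).arrow ≫ M.restr T hUV) := by
  refine (Interpretation.formula_conj_factors (hΔ.conj_inCtx U) _ _ _).2 fun ψ hψ => ?_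
  have h := hΔ.mem U ψ hψ
  have hV : ψ ∈ Phi T V.1 := h.2.mono hUV
  exact (Interpretation.phi_factors_mono hUV h.2 hV _).1
    (Subobject.factors_of_le _ (hΔ.sub_le hM ⟨h.1, hV⟩) (Subobject.factors_self _))

/-- The laws of `restr` are functoriality of `F` for the complex of all finite sets, where every
inclusion is available. -/
theorem restr_refl (U : Finset X) : M.restr T (le_refl U) = 𝟙 (M.ctx T U) :=
  (M.sheaf T ⟨Set.univ, fun _ _ _ _ => trivial, fun _ => trivial⟩).map_id (op ⟨U, trivial⟩)

theorem restr_trans {U V W : Finset X} (h₁ : U ⊆ V) (h₂ : V ⊆ W) :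
    M.restr T h₂ ≫ M.restr T h₁ = M.restr T (h₁.trans h₂) :=
  ((M.sheaf T ⟨Set.univ, fun _ _ _ _ => trivial, fun _ => trivial⟩).map_comp
    (X := op ⟨W, trivial⟩) (Y := op ⟨V, trivial⟩) (Z := op ⟨U, trivial⟩)
    (homOfLE h₂).op (homOfLE h₁).op).symm

/-- The subobjects `sub`, as a presheaf. -/
noncomputable def presheaf : C.Faceᵒᵖ ⥤ S where
  obj U := (hΔ.sub M U.unop : S)
  map f := (hΔ.sub M _).factorThru _ (hΔ.sub_factors_restr hM f.unop.le)
  map_id U := by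
    rw [← cancel_mono (hΔ.sub M U.unop).arrow, Subobject.factorThru_arrow, Category.id_comp]
    exact (congrArg _ (restr_refl _)).trans (Category.comp_id _)
  map_comp {U V W} f g := by
    rw [← cancel_mono (hΔ.sub M W.unop).arrow, Category.assoc, Subobject.factorThru_arrow,
      Subobject.factorThru_arrow, ← Category.assoc, Subobject.factorThru_arrow, Category.assoc,
      restr_trans]

/-- The inclusion of the presheaf into the sheaf `F`. -/
noncomputable def incl : hΔ.presheaf hM ⟶ M.sheaf T C where
  app U := (hΔ.sub M U.unop).arrow
  naturality _ _ f := Subobject.factorThru_arrow _ _ (hΔ.sub_factors_restr hM f.unop.le)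

instance : Mono (hΔ.incl hM) :=
  have : ∀ U, Mono ((hΔ.incl hM).app U) := fun U =>
    inferInstanceAs (Mono (hΔ.sub M U.unop).arrow)
  NatTrans.mono_of_mono_app _

theorem models_incl_iff {φ : Formula T []} :
    Interpretation.Models (hΔ.incl hM) φ ↔
      ∀ (U : C.Face) (h : φ ∈ Phi T U.1), hΔ.sub M U ≤ M.phi U.1 φ h :=
  (Interpretation.models_iff _ _).trans (forall₂_congr fun _ _ =>
    ⟨fun h' => Subobject.le_of_factors h',
      fun h' => Subobject.factors_of_le _ h' (Subobject.factors_self _)⟩)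

theorem models_incl {φ : Formula T []} (h : φ ∈ G) : Interpretation.Models (hΔ.incl hM) φ :=
  (hΔ.models_incl_iff hM).2 fun _ hU => hΔ.sub_le hM ⟨h, hU⟩

end Presheaf

end LocallyAxiomatises

end NoSignallingModel

/-! ### Extension of local assignments, and no-signalling. -/

namespace SetStructure

variable {Sg : Signature.{u}} {X : Type u} {T : X → Sg.Srt} {M : SetStructure Sg}

theorem eval_rename {U : Finset X} (ρ : ∀ x ∈ U, M.carrier (T x)) {l l' : List Sg.Srt}
    (β : ∀ B, BVar l' B → M.carrier B) (r : ∀ B, BVar l B → BVar l' B) {A : Sg.Srt}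
    (t : Term T l A) (h : (t.rename r).InCtx U) :
    M.eval ρ β (t.rename r) h =
      M.eval ρ (fun B b => β B (r B b)) t ((Term.rename_inCtx r).1 h) := by
  induction t with
  | var x => rfl
  | bvar b => rfl
  | app f ts ih => exact congrArg (M.fn f) (funext fun i => ih i (h i))

theorem eval_subst {U V : Finset X} (ρ : ∀ x ∈ V, M.carrier (T x)) {l l' : List Sg.Srt}
    (β : ∀ B, BVar l' B → M.carrier B) {σ : Substitution T l l'} (hσ : σ.Maps U V) {A : Sg.Srt}
    (t : Term T l A) (h : t.InCtx U) :
    M.eval ρ β (t.subst σ) (h.subst hσ) = M.eval (fun x hx => M.eval ρ β (σ.var x) (hσ.1 x hx))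
      (fun B b => M.eval ρ β (σ.bvar B b) (hσ.2 B b)) t h := by
  induction t with
  | var x => rfl
  | bvar b => rfl
  | app f ts ih => exact congrArg (M.fn f) (funext fun i => ih i (h i))

theorem sat_subst {U V : Finset X} (ρ : ∀ x ∈ V, M.carrier (T x)) {l : List Sg.Srt}
    (φ : Formula T l) (h : φ.InCtx U) {l' : List Sg.Srt} (β : ∀ B, BVar l' B → M.carrier B)
    {σ : Substitution T l l'} (hσ : σ.Maps U V) :
    M.Sat ρ (φ.subst σ) (h.subst hσ) β ↔
      M.Sat (fun x hx => M.eval ρ β (σ.var x) (hσ.1 x hx)) φ h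
        (fun B b => M.eval ρ β (σ.bvar B b) (hσ.2 B b)) := by
  induction φ generalizing l' with
  | top => exact Iff.rfl
  | and φ ψ ih₁ ih₂ => exact and_congr (ih₁ h.1 β hσ) (ih₂ h.2 β hσ)
  | eq s t =>
    exact iff_of_eq (congrArg₂ _ (eval_subst ρ β hσ s h.1) (eval_subst ρ β hσ t h.2))
  | rel R ts =>
    exact iff_of_eq (congrArg (M.rel R) (funext fun i => eval_subst ρ β hσ (ts i) (h i)))
  | ex A φ ih =>
    refine exists_congr fun a => (ih h (BVar.cons a β) (hσ.lift A)).trans (iff_of_eq ?_)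
    congr 1
    · funext x hx
      exact eval_rename _ _ _ _ _
    · funext B b
      cases b with
      | zero => rfl
      | succ b => exact eval_rename _ _ _ _ _

end SetStructure

section Extension

variable {Sg : Signature.{u}} {X : Type u} {T : X → Sg.Srt}

open Classical in
/-- The substitution that replaces the named variable `y` by a nameless one. -/
noncomputable def Substitution.abstract (T : X → Sg.Srt) (y : X) : Substitution T [] [T y] where
  var x := if h : y = x then h ▸ .bvar .zero else .var x
  bvar _ b := nomatch b

theorem Substitution.abstract_of_ne {x y : X} (h : y ≠ x) :
    (Substitution.abstract T y).var x = .var x :=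
  dif_neg h

theorem Substitution.abstract_comp_inst (y : X) :
    (Substitution.abstract T y).comp (.inst (.var y)) = .ident T [] := by
  refine Substitution.ext_of (fun x => ?_) fun _ b => nomatch b
  by_cases h : y = x
  · subst h
    simp [comp, abstract, Term.subst, inst, ident]
  · simp [comp, abstract_of_ne h, Term.subst, inst, ident]

theorem Substitution.abstract_maps [DecidableEq X] (y : X) (U : Finset X) :
    (Substitution.abstract T y).Maps (insert y U) U := by
  refine ⟨fun x hx => ?_, fun _ b => nomatch b⟩
  by_cases h : y = x
  · subst h
    simp [abstract, Term.InCtx]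
  · rw [abstract_of_ne h]
    exact (Finset.mem_insert.1 hx).resolve_left (Ne.symm h)

theorem Derives.ex_abstract [DecidableEq X] {Th : Set (Sequent T)} {U : Finset X}
    {φ : Formula T []} {y : X} (hφ : φ.InCtx (insert y U)) :
    Derives Th (insert y U) [] φ (.ex (T y) (φ.subst (.abstract T y))) := by
  have h : (φ.subst (.abstract T y)).InCtx (insert y U) :=
    (hφ.subst (Substitution.abstract_maps y U)).mono (Finset.subset_insert y U)
  have d := Derives.ex_intro (Th := Th) h (t := .var y) (Finset.mem_insert_self y U)
  rwa [Formula.subst_subst, Substitution.abstract_comp_inst, Formula.subst_ident] at d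

namespace LocallyAxiomatises

variable {C : ContextComplex X} {Th : Set (Sequent T)} {G : Set (Formula T [])}
  {Δ : C.Face → List (Formula T [])} (hΔ : LocallyAxiomatises Th G Δ) {M : SetStructure Sg}

include hΔ in
-- This is where closure of `G` enters: `∃ y, ⋀ Δ V` follows from `Δ V`, so it is in `G`; it lives
-- in `U`, so `Δ U` proves it. A witness is the value for `y`.
theorem exists_extension_insert [DecidableEq X] (hM : M.IsModel Th) {U V : C.Face} {y : X}
    (hy : y ∉ U.1) (hV : V.1 = insert y U.1) (ρ : ∀ x ∈ U.1, M.carrier (T x))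
    (h : M.Sat ρ _ (hΔ.conj_inCtx U) BVar.elim0) :
    ∃ ρ' : ∀ x ∈ V.1, M.carrier (T x), (∀ x hx hx', ρ' x hx' = ρ x hx) ∧
      M.Sat ρ' _ (hΔ.conj_inCtx V) BVar.elim0 := by
  obtain ⟨V, hVC⟩ := V
  obtain rfl : V = insert y U.1 := hV
  have hφ : (Formula.conj (Δ ⟨_, hVC⟩)).InCtx (insert y U.1) := hΔ.conj_inCtx ⟨_, hVC⟩
  have hm := Substitution.abstract_maps (T := T) y U.1
  have hχ : (Formula.ex (T y) ((Formula.conj (Δ ⟨_, hVC⟩)).subst (.abstract T y))).InCtx U.1 :=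
    hφ.subst hm
  have hG : Formula.ex (T y) ((Formula.conj (Δ ⟨_, hVC⟩)).subst (.abstract T y)) ∈ G :=
    hΔ.closed ⟨_, hVC⟩ _ (Derives.ex_abstract hφ)
  obtain ⟨a, ha⟩ := hM.sat_of_derives (hΔ.derives U _ ⟨hG, hχ⟩) (hΔ.conj_inCtx U) hχ h
  rw [SetStructure.sat_subst ρ _ hφ _ hm] at ha
  refine ⟨fun x hx => M.eval ρ (BVar.cons a BVar.elim0) ((Substitution.abstract T y).var x)
    (hm.1 x hx), fun x hx hx' => ?_, ?_⟩
  · have hne : y ≠ x := fun h => hy (h ▸ hx)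
    -- The term is generalised because its context proof depends on it, which prevents rewriting.
    have key : ∀ (t : Term T [T y] (T x)) (ht : t.InCtx U.1), t = .var x →
        M.eval ρ (BVar.cons a BVar.elim0) t ht = ρ x hx := by
      rintro _ _ rfl
      rfl
    exact key _ _ (Substitution.abstract_of_ne hne)
  · convert ha using 1
    funext B b
    exact nomatch b

include hΔ in
-- Variables are added one at a time; the intermediate contexts are subsets of `V`, hence faces.
theorem exists_extension (hM : M.IsModel Th) {U V : C.Face} (hUV : U.1 ⊆ V.1)
    (ρ : ∀ x ∈ U.1, M.carrier (T x)) (h : M.Sat ρ _ (hΔ.conj_inCtx U) BVar.elim0) :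
    ∃ ρ' : ∀ x ∈ V.1, M.carrier (T x), (∀ x hx hx', ρ' x hx' = ρ x hx) ∧
      M.Sat ρ' _ (hΔ.conj_inCtx V) BVar.elim0 := by
  classical
  have key : ∀ (W : Finset X) (V : C.Face), V.1 = U.1 ∪ W →
      ∃ ρ' : ∀ x ∈ V.1, M.carrier (T x), (∀ x hx hx', ρ' x hx' = ρ x hx) ∧
        M.Sat ρ' _ (hΔ.conj_inCtx V) BVar.elim0 := by
    intro W
    induction W using Finset.induction_on with
    | empty =>
      intro V hV
      obtain rfl : V = U := Subtype.ext (hV.trans (Finset.union_empty _))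
      exact ⟨ρ, fun _ _ _ => rfl, h⟩
    | insert y W _ ih =>
      intro V hV
      rw [Finset.union_insert] at hV
      by_cases hy : y ∈ U.1 ∪ W
      · exact ih V (hV.trans (Finset.insert_eq_self.2 hy))
      · let V' : C.Face := ⟨U.1 ∪ W, C.down_closed V.2 (hV ▸ Finset.subset_insert y _)⟩
        obtain ⟨ρ₁, h₁, hs₁⟩ := ih V' rfl
        obtain ⟨ρ₂, h₂, hs₂⟩ := hΔ.exists_extension_insert hM (U := V') hy hV ρ₁ hs₁
        refine ⟨ρ₂, fun x hx hx' => ?_, hs₂⟩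
        exact (h₂ x (Finset.mem_union_left _ hx) hx').trans (h₁ x hx _)
  exact key V.1 V (Finset.union_eq_right.2 hUV).symm

open SmallSet

theorem mem_sub_iff {V : C.Face} (p : (M.interpretation.ctx T V.1 : SmallSet.{v, w} _).El) :
    Mem p (hΔ.sub M.interpretation V) ↔ M.Sat
      (fun x hx => M.value (Pi.π (fun x : {x // x ∈ V.1} => M.interpretation.obj (T x)) ⟨x, hx⟩) p)
      _ (hΔ.conj_inCtx V) BVar.elim0 := by
  refine (M.mem_formula _ (hΔ.conj_inCtx V) _ _ p).trans (iff_of_eq ?_)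
  congr 1
  funext B b
  exact nomatch b

theorem noSignalling (hM : M.IsModel Th) :
    NoSignalling (hΔ.presheaf (SetStructure.interpretation_isModel.{v, w} M hM)) := by
  intro V U f
  have hUV : U.unop.1 ⊆ V.unop.1 := f.unop.le
  refine isRegularEpi_of_surjective _ fun a => ?_
  let p : (M.interpretation.ctx T U.unop.1 : SmallSet.{v, w} _).El :=
    ap (hΔ.sub M.interpretation U.unop).arrow a
  have hp := (hΔ.mem_sub_iff p).1 (mem_iff_exists.2 ⟨a, rfl⟩)
  obtain ⟨ρ', hρ', hs⟩ := hΔ.exists_extension hM hUV _ hp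
  -- The extended assignment as an element of `F_V`; it lies in `A_V` and restricts to `a`.
  let q : (M.interpretation.ctx T V.unop.1 : SmallSet.{v, w} _).El :=
    tuple fun x : {x // x ∈ V.unop.1} => M.codeEquiv (T x) (ρ' x.1 x.2)
  have hπ : ∀ x, ap (Pi.π (fun x : {x // x ∈ V.unop.1} => M.interpretation.obj (T x)) x) q =
      M.codeEquiv (T x) (ρ' x.1 x.2) := ap_π_tuple _
  have hq : Mem q (hΔ.sub M.interpretation V.unop) := by
    refine (hΔ.mem_sub_iff q).2 ?_
    convert hs using 3 with x hx
    exact (congrArg _ (hπ ⟨x, hx⟩)).trans ((M.codeEquiv _).symm_apply_apply _)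
  obtain ⟨b, hb⟩ := mem_iff_exists.1 hq
  refine ⟨b, injective_of_mono (hΔ.sub M.interpretation U.unop).arrow ?_⟩
  have hr : ap (hΔ.sub M.interpretation U.unop).arrow
      (ap ((hΔ.presheaf (SetStructure.interpretation_isModel.{v, w} M hM)).map f) b) =
      ap (M.interpretation.restr T hUV) q := by
    rw [← hb]
    exact congrArg (fun f => ap f b) (Subobject.factorThru_arrow _ _
      (hΔ.sub_factors_restr (SetStructure.interpretation_isModel.{v, w} M hM) hUV))
  refine hr.trans (pi_ext fun x => ?_)
  have h₁ : ap (Pi.π (fun x : {x // x ∈ U.unop.1} => M.interpretation.obj (T x)) x)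
      (ap (M.interpretation.restr T hUV) q) =
      ap (Pi.π (fun x : {x // x ∈ V.unop.1} => M.interpretation.obj (T x)) ⟨x.1, hUV x.2⟩) q :=
    congrArg (fun f => ap f q) (Pi.lift_π (fun x : {x // x ∈ U.unop.1} =>
      Pi.π (fun x : {x // x ∈ V.unop.1} => M.interpretation.obj (T x)) ⟨x.1, hUV x.2⟩) x)
  refine h₁.trans ((hπ ⟨x.1, hUV x.2⟩).trans ?_)
  rw [hρ' x.1 x.2]
  exact (M.codeEquiv _).apply_symm_apply _

end LocallyAxiomatises

end Extension

/-! ### Closure of the inchworm consequences, and the theorem. -/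

namespace ContextComplex

variable {Sg : Signature.{u}} {X : Type u} {T : X → Sg.Srt} {C : ContextComplex X}
  {Th : Set (Sequent T)}

theorem Inchworm.mem_phiC {Γ : Set (Formula T [])} {φ : Formula T []} (h : C.Inchworm Th Γ φ) :
    φ ∈ C.PhiC T := by
  induction h with
  | base U hU hφ _ => exact Set.mem_biUnion hU hφ
  | cut _ _ _ ih => exact ih

theorem Inchworm.of_mem {Γ : Set (Formula T [])} {φ : Formula T []} (hφ : φ ∈ Γ)
    (hC : φ ∈ C.PhiC T) : C.Inchworm Th Γ φ := by
  obtain ⟨U, hU, h⟩ := Set.mem_iUnion₂.1 hC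
  refine .base U hU h ⟨[φ], by simpa using ⟨hφ, h⟩, ?_⟩
  exact .and_left h trivial

/-- Cut against one formula at a time with `Γ` on both sides, so that the union of the premises adds
nothing new. -/
theorem Inchworm.cut_list {Γ : Set (Formula T [])} {Δ : List (Formula T [])}
    (hΔ : ∀ ψ ∈ Δ, C.Inchworm Th Γ ψ) {φ : Formula T []}
    (h : C.Inchworm Th (Γ ∪ {ψ | ψ ∈ Δ}) φ) : C.Inchworm Th Γ φ := by
  induction Δ with
  | nil => simpa using h
  | cons ψ Δ ih =>
    refine ih (fun χ hχ => hΔ χ (by simp [hχ])) ?_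
    have h' : C.Inchworm Th (insert ψ (Γ ∪ {ψ | ψ ∈ Δ})) φ := by
      convert h using 1
      ext χ
      simp only [Set.mem_insert_iff, Set.mem_union, Set.mem_ofPred_eq, List.mem_cons]
      tauto
    have := Inchworm.cut (hΔ ψ (by simp)) h'
    rwa [← Set.union_assoc, Set.union_self] at this

/-- The closure of `Γ` is itself closed under derivation within any one context. -/
theorem Inchworm.of_derives {Γ : Set (Formula T [])} {Δ : List (Formula T [])} {U : Finset X}
    (hU : U ∈ C.faces) (hΔ : ∀ ψ ∈ Δ, C.Inchworm Th Γ ψ) {φ : Formula T []}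
    (h : Derives Th U [] (Formula.conj Δ) φ) : C.Inchworm Th Γ φ :=
  .cut_list hΔ (.base U hU h.inCtx.2
    ⟨Δ, fun ψ hψ => ⟨Or.inr hψ, Formula.conj_inCtx.1 h.inCtx.1 ψ hψ⟩, h⟩)

/-- The finiteness hypothesis is applied to the closure of `Γ`, not to `Γ`, so that the axioms of a
context include what is learnt through other contexts. -/
theorem LocallyFinitelyAxiomatised.exists_locallyAxiomatises
    (hfin : C.LocallyFinitelyAxiomatised Th) (Γ : Set (Formula T [])) :
    ∃ Δ : C.Face → List (Formula T []),
      LocallyAxiomatises Th {ψ | C.Inchworm Th Γ ψ} Δ := by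
  choose Δ hf hsub hent using fun U : C.Face =>
    hfin {ψ | C.Inchworm Th Γ ψ} (fun _ h => h.mem_phiC) U.1 U.2
  have hmem : ∀ U ψ, ψ ∈ (hf U).toFinset.toList ↔ ψ ∈ Δ U := by simp
  have hc : ∀ U : C.Face, ∀ ψ ∈ (hf U).toFinset.toList, ψ.InCtx U.1 := fun U ψ hψ =>
    (hsub U ((hmem U ψ).1 hψ)).2
  refine ⟨fun U => (hf U).toFinset.toList, fun U ψ hψ => hsub U ((hmem U ψ).1 hψ),
    fun U ψ hψ => ?_, fun U ψ hψ => ?_⟩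
  · obtain ⟨Δ', hΔ', d⟩ := hent U ψ hψ
    refine Derives.cut (.conj_intro (Formula.conj_inCtx.2 (hc U)) fun χ hχ => ?_) d
    exact .conj_of_mem (hc U) ((hmem U χ).2 (hΔ' χ hχ))
  · exact Inchworm.of_derives U.2 (fun χ hχ => (hsub U ((hmem U χ).1 hχ)).1) hψ

end ContextComplex

theorem theorem25 {Sg : Signature.{u}} {X : Type u} (T : X → Sg.Srt) (C : ContextComplex X)
    (Th : Set (Sequent T)) (hfin : C.LocallyFinitelyAxiomatised Th)
    (Γ : Set (Formula T [])) (hΓ : Γ ⊆ C.PhiC T) (φ : Formula T []) (hφ : φ ∈ C.PhiC T) :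
    C.Inchworm Th Γ φ ↔
      ∀ (S : Type (max u w)) [Category.{max u v} S] [Regular S] (M : Interpretation Sg S),
        M.IsModel Th →
        ∀ (A : C.Faceᵒᵖ ⥤ S) (ι : A ⟶ M.sheaf T C) [Mono ι], NoSignalling A →
          (∀ ψ ∈ Γ, Interpretation.Models ι ψ) → Interpretation.Models ι φ := by
  refine ⟨fun h S _ _ M hM A ι _ hA hΓA => Interpretation.models_of_inchworm ι hM hA h hΓA,
    fun h => ?_⟩
  obtain ⟨U, hU, hφU⟩ := Set.mem_iUnion₂.1 hφ
  obtain ⟨Δ, hΔ⟩ := hfin.exists_locallyAxiomatises Γ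
  by_contra hn
  have hd : ¬ Derives Th U [] (Formula.conj (Δ ⟨U, hU⟩)) φ := fun d =>
    hn (hΔ.closed ⟨U, hU⟩ φ d)
  obtain ⟨M, hM, ρ, hs, hns⟩ :=
    exists_setStructure_of_not_derives (hΔ.conj_inCtx ⟨U, hU⟩) hφU hd
  have hI := SetStructure.interpretation_isModel.{v, w} M hM
  have hA := h _ _ hI (hΔ.presheaf hI) (hΔ.incl hI) (hΔ.noSignalling hM)
    fun ψ hψ => hΔ.models_incl hI (ContextComplex.Inchworm.of_mem hψ (hΓ hψ))
  have hle := (hΔ.models_incl_iff hI).1 hA ⟨U, hU⟩ hφU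
  -- The assignment that refutes `φ`, as an element of `F_U`: it lies in `A_U` but not in `⟦φ⟧_U`.
  let q : (M.interpretation.ctx T U : SmallSet.{v, w} _).El :=
    SmallSet.tuple fun x : {x // x ∈ U} => M.codeEquiv (T x) (ρ x.1 x.2)
  have hπ : (fun x hx => M.value (Pi.π (fun x : {x // x ∈ U} => M.interpretation.obj (T x))
      ⟨x, hx⟩) q) = ρ := by
    funext x hx
    exact (congrArg (M.codeEquiv _).symm (SmallSet.ap_π_tuple _ (⟨x, hx⟩ : {x // x ∈ U}))).trans
      ((M.codeEquiv _).symm_apply_apply _)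
  have hq := SmallSet.le_iff_mem.1 hle q ((hΔ.mem_sub_iff (V := ⟨U, hU⟩) q).2 (by
    change M.Sat (fun x hx => M.value (Pi.π (fun x : {x // x ∈ U} =>
      M.interpretation.obj (T x)) ⟨x, hx⟩) q) _ _ _
    rw [hπ]
    exact hs))
  have hq' := (M.mem_formula φ hφU _ _ q).1 hq
  refine hns ((iff_of_eq ?_).1 hq')
  congr 1
  funext B b
  exact nomatch b
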